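/- Let $a>0$ be real. The Buckley–Osthus random multigraph $H_{a,1}^n$ on the vertices $1,\dots,n$ is built inductively from the empty graph $H_{a,1}^0$: at step $t\ge 1$ one adds the vertex $t$ and one edge joining $t$ to a random vertex $i\in\{1,\dots,t\}$, where, conditionally on $H_{a,1}^{t-1}$, $$\mathsf P(i=s)=\begin{cases}\dfrac{d_{H_{a,1}^{t-1}}(s)-1+a}{(a+1)t-1}, & 1\le s\le t-1,\\[2mm] \dfrac{a}{(a+1)t-1}, & s=t,\end{cases}$$ and $d_{H}(s)$ is the degree of the vertex $s$ in $H$ (a loop counts twice). The second degree $d_2(t)$ of a vertex $t$ of $H_{a,1}^n$ is the number of edges that are incident to a neighbour of $t$ but not to $t$ itself, and $Y_n(k)$ is the number of vertices $t$ of $H_{a,1}^n$ with $d_2(t)\ge k$. Then there is a constant $C>0$, depending only on $a$, such that for all integers $n\ge 1$ and $k>1$ $$\mathsf E\,Y_n(k)=\frac{(a+1)\,\Gamma(2a+1)}{\Gamma(a+1)\,k^{a}}\;n\,\bigl(1+\varepsilon_1+\varepsilon_2\bigr)$$ for some real numbers $\varepsilon_1=\varepsilon_1(n,k)$ and $\varepsilon_2=\varepsilon_2(n,k)$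 with $$|\varepsilon_1|\le C\,\frac{(\ln k)^{\lceil a+1\rceil}}{k},\qquad |\varepsilon_2|\le C\,\frac{k^{1+a}}{n}.$$ -/

import Mathlib

open Finset

namespace BuckleyOsthus

/-- A possible value of the random multigraph on the `n` vertices `Fin n` (the vertex of index
`t : Fin n` is the one that arrives at time `t + 1`): each vertex `t` sends exactly one edge, to
a vertex of index at most `t` (to itself if the edge is a loop). -/
abbrev Graph (n : ℕ) : Type := (t : Fin n) → Fin ((t : ℕ) + 1)

/-- The vertex to which the vertex `t` sends its edge. -/
def target {n : ℕ} (G : Graph n) (t : Fin n) : Fin n := (G t).castLE t.isLt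

/-- The unordered pair of ends of the edge sent by the vertex `e`. The edges of the multigraph
are indexed by the vertices that send them. -/
def ends {n : ℕ} (G : Graph n) (e : Fin n) : Sym2 (Fin n) := s(e, target G e)

/-- The degree of a vertex; a loop contributes `2`. -/
def degree {n : ℕ} (G : Graph n) (s : Fin n) : ℕ :=
  ∑ e : Fin n, ((if e = s then 1 else 0) + (if target G e = s then 1 else 0))

/-- The second degree of `t`: the number of edges that are incident to a neighbour of `t`
but not to `t` itself. -/
def secondDegree {n : ℕ} (G : Graph n) (t : Fin n) : ℕ :=
  #{e : Fin n | t ∉ ends G e ∧ ∃ i, i ∈ ends G e ∧ ∃ e', ends G e' = s(i, t)}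

/-- The number of vertices of second degree at least `k`. -/
def numKVertices (k : ℕ) {n : ℕ} (G : Graph n) : ℕ :=
  #{t : Fin n | k ≤ secondDegree G t}

/-- Given the graph `G` on the first `n` vertices, the probability that the new vertex (the one
with index `n`, arriving at time `n + 1`) sends its edge to the vertex `s`. -/
noncomputable def attachProb (a : ℝ) {n : ℕ} (G : Graph n) (s : Fin (n + 1)) : ℝ :=
  if h : (s : ℕ) < n then
    ((degree G ⟨s, h⟩ : ℝ) - 1 + a) / ((a + 1) * ((n : ℝ) + 1) - 1)
  else
    a / ((a + 1) * ((n : ℝ) + 1) - 1)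

theorem one_le_degree {n : ℕ} (G : Graph n) (s : Fin n) : 1 ≤ degree G s := by
  unfold degree
  calc 1 ≤ (if s = s then 1 else 0) + (if target G s = s then 1 else 0) := by simp
    _ ≤ _ := Finset.single_le_sum
      (f := fun e : Fin n => (if e = s then 1 else 0) + (if target G e = s then 1 else 0))
      (fun _ _ => Nat.zero_le _) (Finset.mem_univ s)

theorem sum_degree {n : ℕ} (G : Graph n) : ∑ s, degree G s = 2 * n := by
  unfold degree
  rw [Finset.sum_comm]
  simp [Finset.sum_add_distrib]
  ring

theorem denom_pos {a : ℝ} (ha : 0 < a) (n : ℕ) : 0 < (a + 1) * ((n : ℝ) + 1) - 1 := by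
  have hn : (0 : ℝ) ≤ n := Nat.cast_nonneg n
  nlinarith [mul_nonneg ha.le hn]

theorem attachProb_nonneg {a : ℝ} (ha : 0 < a) {n : ℕ} (G : Graph n) (s : Fin (n + 1)) :
    0 ≤ attachProb a G s := by
  have hd := denom_pos ha n
  unfold attachProb
  split_ifs with h
  · have h1 : (1 : ℝ) ≤ degree G ⟨s, h⟩ := by exact_mod_cast one_le_degree G ⟨s, h⟩
    exact div_nonneg (by linarith) hd.le
  · exact div_nonneg ha.le hd.le

theorem sum_attachProb {a : ℝ} (ha : 0 < a) {n : ℕ} (G : Graph n) :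
    ∑ s, attachProb a G s = 1 := by
  have hd := denom_pos ha n
  have hs : ∑ s : Fin n, (degree G s : ℝ) = 2 * n := by exact_mod_cast sum_degree G
  rw [Fin.sum_univ_castSucc]
  simp only [attachProb, Fin.val_castSucc, Fin.is_lt, dif_pos, Fin.val_last, lt_irrefl,
    dif_neg, not_false_eq_true, Fin.eta]
  rw [← Finset.sum_div, ← add_div, div_eq_one_iff_eq hd.ne', Finset.sum_add_distrib,
    Finset.sum_sub_distrib, hs]
  simp
  ring

/-- The conditional law of the end of the edge sent by the new vertex. -/
noncomputable def attachPMF (a : ℝ) (ha : 0 < a) {n : ℕ} (G : Graph n) : PMF (Fin (n + 1)) :=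
  PMF.ofFintype (fun s => ENNReal.ofReal (attachProb a G s)) (by
    rw [← ENNReal.ofReal_sum_of_nonneg (fun s _ => attachProb_nonneg ha G s),
      sum_attachProb ha G, ENNReal.ofReal_one])

/-- The graph obtained from `G` by adding one vertex together with its edge, sent to `s`. -/
def addVertex {n : ℕ} (G : Graph n) (s : Fin (n + 1)) : Graph (n + 1) :=
  Fin.snoc (α := fun t : Fin (n + 1) => Fin ((t : ℕ) + 1)) G s

/-- The law of the Buckley–Osthus random graph with initial attractiveness `a` and one edge per
vertex, on `n` vertices; one starts from the empty graph. -/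
noncomputable def law (a : ℝ) (ha : 0 < a) : (n : ℕ) → PMF (Graph n)
  | 0 => PMF.pure (fun t => t.elim0)
  | n + 1 => (law a ha n).bind fun G => (attachPMF a ha G).map (addVertex G)

/-- The expected number of vertices of second degree at least `k` in the Buckley–Osthus random
graph on `n` vertices. -/
noncomputable def expectedKVertices (a : ℝ) (ha : 0 < a) (n k : ℕ) : ℝ :=
  ∑ G : Graph n, (law a ha n G).toReal * (numKVertices k G : ℝ)

end BuckleyOsthus

namespace BuckleyOsthus

/-! Apart from loops, the edges counted by the second degree of `t` enter or leave its parent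
`target G t`, or enter a child of `t`. So `secondDegree` is `parentDeg` up to one, plus at most
`grandDeg`, and the power law comes from `parentDeg` alone.

Main term. By double counting, the vertices whose parent has indegree at least `k` number `∑ indeg
v` over the `v` with `indeg v ≥ k`, that is `n` minus a combination of the numbers of vertices of
indegree `j < k`. The expectations of these satisfy a linear recursion with solution `(n + a/(a+1))
* limitFreq a j`, up to an error `O(1/(j+a))` uniform in `n` (`degError_bound`). The tail sum
telescopes to `limitTail`, a Gamma ratio equal to `tailConst a / k^a` up to `O(k^(-a-1))`
(`limitTail_bound`). The total error is `O(k)`.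

Error term. Loops cost `1 + log n` (`expect_numLoops_le`). What remains are the exceptions:
`parentDeg < k ≤ parentDeg + grandDeg`. A moment of `grandDeg`, weighted by a function of
`parentDeg`, is propagated in time by a one-step inequality (`weightedMoment_succ_le`) whose test
function is a rising product in `grandDeg + s * indeg`, with `s` decreasing in time. This yields
polynomial tails for `grandDeg`, jointly with the event `parentDeg = z` (`weightedMoment_one_le`,
`weightedMoment_indicator_le`). Old vertices, up to about `n (log k / k)^(a+1)`, are bounded
trivially; they produce the power of the logarithm (`sum_exceptionProb_bound`). -/

/-- Expectation of a functional of the random graph on `n` vertices. -/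
noncomputable def expect (a : ℝ) (ha : 0 < a) (n : ℕ) (f : Graph n → ℝ) : ℝ :=
  ∑ G : Graph n, (law a ha n G).toReal * f G

/-- The normalizing constant of the attachment probabilities given the graph on `n` vertices. -/
noncomputable def denom (a : ℝ) (n : ℕ) : ℝ := (a + 1) * ((n : ℝ) + 1) - 1

/-- The number of edges sent to `s`; a loop contributes `1`. -/
def indeg {n : ℕ} (G : Graph n) (s : Fin n) : ℕ := #{e : Fin n | target G e = s}

/-! ### Expectations under the law of the graph -/

section Expectation

variable {a : ℝ} {ha : 0 < a} {n : ℕ}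

theorem sum_law (a : ℝ) (ha : 0 < a) (n : ℕ) : ∑ G : Graph n, (law a ha n G).toReal = 1 := by
  have h := (law a ha n).tsum_coe
  rw [tsum_fintype] at h
  rw [← ENNReal.toReal_sum (fun G _ => (law a ha n).apply_ne_top G), h, ENNReal.toReal_one]

theorem expect_const (c : ℝ) : expect a ha n (fun _ => c) = c := by
  unfold expect
  rw [← Finset.sum_mul, sum_law, one_mul]

theorem expect_mono {f g : Graph n → ℝ} (h : ∀ G, f G ≤ g G) :
    expect a ha n f ≤ expect a ha n g :=
  Finset.sum_le_sum fun G _ => mul_le_mul_of_nonneg_left (h G) ENNReal.toReal_nonneg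

theorem expect_nonneg {f : Graph n → ℝ} (h : ∀ G, 0 ≤ f G) : 0 ≤ expect a ha n f :=
  Finset.sum_nonneg fun G _ => mul_nonneg ENNReal.toReal_nonneg (h G)

theorem expect_add (f g : Graph n → ℝ) :
    expect a ha n (fun G => f G + g G) = expect a ha n f + expect a ha n g := by
  simp only [expect, mul_add, Finset.sum_add_distrib]

theorem expect_sub (f g : Graph n → ℝ) :
    expect a ha n (fun G => f G - g G) = expect a ha n f - expect a ha n g := by
  simp only [expect, mul_sub, Finset.sum_sub_distrib]

theorem expect_const_mul (c : ℝ) (f : Graph n → ℝ) :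
    expect a ha n (fun G => c * f G) = c * expect a ha n f := by
  simp only [expect, Finset.mul_sum]
  exact Finset.sum_congr rfl fun G _ => by ring

theorem expect_sum {ι : Type*} (s : Finset ι) (f : ι → Graph n → ℝ) :
    expect a ha n (fun G => ∑ i ∈ s, f i G) = ∑ i ∈ s, expect a ha n (f i) := by
  simp only [expect, Finset.mul_sum]
  exact Finset.sum_comm

theorem toReal_law_succ (G' : Graph (n + 1)) :
    (law a ha (n + 1) G').toReal = ∑ G : Graph n, (law a ha n G).toReal *
      ∑ s, attachProb a G s * if G' = addVertex G s then 1 else 0 := by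
  have h : law a ha (n + 1) G' = ∑ G : Graph n, law a ha n G *
      ∑ s, if G' = addVertex G s then ENNReal.ofReal (attachProb a G s) else 0 := by
    rw [law, PMF.bind_apply, tsum_fintype]
    refine Finset.sum_congr rfl fun G _ => ?_
    rw [PMF.map_apply, tsum_fintype]
    congr 1
    refine Finset.sum_congr rfl fun s _ => ?_
    split_ifs <;> rfl
  have hfin : ∀ G : Graph n,
      (∑ s, if G' = addVertex G s then ENNReal.ofReal (attachProb a G s) else 0) ≠ ⊤ := by
    intro G
    refine ENNReal.sum_ne_top.2 fun s _ => ?_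
    split_ifs <;> simp
  rw [h, ENNReal.toReal_sum fun G _ =>
    ENNReal.mul_ne_top ((law a ha n).apply_ne_top G) (hfin G)]
  refine Finset.sum_congr rfl fun G _ => ?_
  rw [ENNReal.toReal_mul, ENNReal.toReal_sum]
  · congr 1
    refine Finset.sum_congr rfl fun s _ => ?_
    split_ifs
    · rw [ENNReal.toReal_ofReal (attachProb_nonneg ha G s), mul_one]
    · simp
  · intro s _
    split_ifs <;> simp

/-- Conditioning on the first `n` steps; every recursion in time below is an instance. -/
theorem expect_succ (f : Graph (n + 1) → ℝ) :
    expect a ha (n + 1) f =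
      expect a ha n fun G => ∑ s, attachProb a G s * f (addVertex G s) := by
  unfold expect
  simp only [toReal_law_succ, Finset.sum_mul]
  rw [Finset.sum_comm]
  refine Finset.sum_congr rfl fun G _ => ?_
  simp only [mul_assoc, ← Finset.mul_sum, Finset.sum_mul]
  rw [Finset.sum_comm]
  congr 1
  refine Finset.sum_congr rfl fun s _ => ?_
  rw [← Finset.mul_sum]
  simp

theorem denom_pos' (ha : 0 < a) (n : ℕ) : 0 < denom a n := denom_pos ha n

end Expectation

/-! ### Indegrees and attachment probabilities -/

section Attachment

variable {n : ℕ}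

theorem degree_eq_indeg (G : Graph n) (s : Fin n) : degree G s = 1 + indeg G s := by
  unfold degree indeg
  rw [Finset.sum_add_distrib, Finset.card_filter]
  simp

theorem target_addVertex_castSucc (G : Graph n) (s : Fin (n + 1)) (e : Fin n) :
    target (addVertex G s) e.castSucc = (target G e).castSucc := by
  unfold target addVertex
  rw [Fin.snoc_castSucc]
  rfl

theorem target_addVertex_last (G : Graph n) (s : Fin (n + 1)) :
    target (addVertex G s) (Fin.last n) = s := by
  unfold target addVertex
  rw [Fin.snoc_last]
  rfl

theorem target_le (G : Graph n) (e : Fin n) : target G e ≤ e := by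
  rw [Fin.le_def]
  exact Nat.lt_succ_iff.1 (G e).isLt

theorem indeg_addVertex_castSucc (G : Graph n) (s : Fin (n + 1)) (v : Fin n) :
    indeg (addVertex G s) v.castSucc = indeg G v + if s = v.castSucc then 1 else 0 := by
  unfold indeg
  simp only [Finset.card_filter, Fin.sum_univ_castSucc, target_addVertex_castSucc,
    target_addVertex_last, Fin.castSucc_inj]

theorem indeg_addVertex_last (G : Graph n) (s : Fin (n + 1)) :
    indeg (addVertex G s) (Fin.last n) = if s = Fin.last n then 1 else 0 := by
  unfold indeg
  simp only [Finset.card_filter, Fin.sum_univ_castSucc, target_addVertex_castSucc,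
    target_addVertex_last, Fin.castSucc_ne_last]
  simp

theorem indeg_le (G : Graph n) (v : Fin n) : indeg G v ≤ n := by
  unfold indeg
  exact (Finset.card_le_univ _).trans (by simp)

theorem attachProb_castSucc {a : ℝ} (G : Graph n) (v : Fin n) :
    attachProb a G v.castSucc = (indeg G v + a) / denom a n := by
  simp [attachProb, degree_eq_indeg, denom]

theorem attachProb_last {a : ℝ} (G : Graph n) :
    attachProb a G (Fin.last n) = a / denom a n := by
  simp [attachProb, denom]

theorem sum_attachProb_mul {a : ℝ} (G : Graph n) (f : Fin (n + 1) → ℝ) :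
    ∑ s, attachProb a G s * f s =
      ∑ v : Fin n, (indeg G v + a) / denom a n * f v.castSucc + a / denom a n * f (Fin.last n) := by
  simp only [Fin.sum_univ_castSucc, attachProb_castSucc, attachProb_last]

/-- Double counting of pairs (edge, its target). It turns statistics of parents into size-biased
statistics of indegrees. -/
theorem sum_indeg_mul (G : Graph n) (f : Fin n → ℝ) :
    ∑ v, (indeg G v : ℝ) * f v = ∑ e, f (target G e) := by
  unfold indeg
  simp only [Finset.card_filter, Nat.cast_sum, Finset.sum_mul]
  rw [Finset.sum_comm]
  refine Finset.sum_congr rfl fun e _ => ?_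
  simp

theorem sum_indeg (G : Graph n) : ∑ v, (indeg G v : ℝ) = n := by
  simpa using sum_indeg_mul G (fun _ => 1)

end Attachment

/-! ### Expected indegree counts and their limiting frequencies -/

/-- The expected number of vertices of indegree `j`. -/
noncomputable def degCount (a : ℝ) (ha : 0 < a) (n j : ℕ) : ℝ :=
  expect a ha n fun G => ∑ v : Fin n, if indeg G v = j then (1 : ℝ) else 0

/-- The limiting proportion of the vertices of indegree `j`. -/
noncomputable def limitFreq (a : ℝ) : ℕ → ℝ
  | 0 => (a + 1) / (2 * a + 1)
  | j + 1 => limitFreq a j * (j + a) / (j + 2 * a + 2)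

section DegreeCount

variable {a : ℝ} {ha : 0 < a} {n : ℕ}

theorem sum_attachProb_mul_indicator (ha : 0 < a) (G : Graph n) (w : Fin (n + 1)) (x y : ℝ) :
    ∑ s, attachProb a G s * (if s = w then x else y) = y + attachProb a G w * (x - y) := by
  have h : ∀ s, attachProb a G s * (if s = w then x else y) =
      attachProb a G s * y + if s = w then attachProb a G s * (x - y) else 0 := by
    intro s
    split_ifs <;> ring
  simp only [h, Finset.sum_add_distrib, ← Finset.sum_mul, sum_attachProb ha G, one_mul,
    Finset.sum_ite_eq', Finset.mem_univ, if_true]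

theorem sum_attachProb_indeg (ha : 0 < a) (G : Graph n) (g : ℕ → ℝ) :
    ∑ s, attachProb a G s * ∑ v, g (indeg (addVertex G s) v) =
      ∑ v, (g (indeg G v) + (indeg G v + a) / denom a n * (g (indeg G v + 1) - g (indeg G v)))
        + (g 0 + a / denom a n * (g 1 - g 0)) := by
  simp only [Finset.mul_sum, Fin.sum_univ_castSucc (n := n) (fun v => g _), Finset.sum_add_distrib,
    mul_add]
  rw [Finset.sum_comm]
  have h1 : ∀ v : Fin n, ∑ s, attachProb a G s * g (indeg (addVertex G s) v.castSucc) =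
      g (indeg G v) + (indeg G v + a) / denom a n * (g (indeg G v + 1) - g (indeg G v)) := by
    intro v
    rw [← attachProb_castSucc, ← sum_attachProb_mul_indicator ha]
    refine Finset.sum_congr rfl fun s _ => ?_
    rw [indeg_addVertex_castSucc]
    split_ifs <;> rfl
  have h2 : ∑ s, attachProb a G s * g (indeg (addVertex G s) (Fin.last n)) =
      g 0 + a / denom a n * (g 1 - g 0) := by
    rw [← attachProb_last G, ← sum_attachProb_mul_indicator ha]
    refine Finset.sum_congr rfl fun s _ => ?_
    rw [indeg_addVertex_last]
    split_ifs <;> rfl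
  simp only [h1, h2, Finset.sum_add_distrib]

theorem degCount_nonneg (j : ℕ) : 0 ≤ degCount a ha n j :=
  expect_nonneg fun _ => Finset.sum_nonneg fun _ _ => by split_ifs <;> norm_num

theorem degCount_le (j : ℕ) : degCount a ha n j ≤ n := by
  rw [← expect_const (a := a) (ha := ha) (n := n) (n : ℝ)]
  refine expect_mono fun G => ?_
  calc _ ≤ ∑ _v : Fin n, (1 : ℝ) := Finset.sum_le_sum fun v _ => by split_ifs <;> norm_num
    _ = n := by simp

theorem degCount_eq_zero {j : ℕ} (h : n < j) : degCount a ha n j = 0 := by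
  unfold degCount
  refine Eq.trans ?_ (expect_const (a := a) (ha := ha) (n := n) 0)
  congr 1
  funext G
  refine Finset.sum_eq_zero fun v _ => if_neg ?_
  have := indeg_le G v
  omega

theorem degCount_succ_zero :
    degCount a ha (n + 1) 0 = degCount a ha n 0 * (1 - a / denom a n) + (1 - a / denom a n) := by
  unfold degCount
  rw [expect_succ, mul_comm, ← expect_const_mul, ← expect_const (a := a) (ha := ha) (n := n)
    (1 - a / denom a n), ← expect_add]
  congr 1
  funext G
  rw [sum_attachProb_indeg ha G (fun d => if d = 0 then (1 : ℝ) else 0), expect_const,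
    Finset.mul_sum]
  congr 1
  · refine Finset.sum_congr rfl fun v _ => ?_
    by_cases h : indeg G v = 0
    · simp [h]; ring
    · simp [h]
  · simp; ring

theorem degCount_succ_succ (j : ℕ) :
    degCount a ha (n + 1) (j + 1) = degCount a ha n (j + 1) * (1 - (j + 1 + a) / denom a n)
      + degCount a ha n j * ((j + a) / denom a n) + if j = 0 then a / denom a n else 0 := by
  unfold degCount
  rw [expect_succ, mul_comm, ← expect_const_mul, mul_comm (expect a ha n _), ← expect_const_mul,
    ← expect_add]
  conv_rhs => rw [← expect_const (a := a) (ha := ha) (n := n) (if j = 0 then a / denom a n else 0)]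
  rw [← expect_add]
  congr 1
  funext G
  rw [sum_attachProb_indeg ha G (fun d => if d = j + 1 then (1 : ℝ) else 0),
    Finset.mul_sum, Finset.mul_sum, ← Finset.sum_add_distrib]
  congr 1
  · refine Finset.sum_congr rfl fun v _ => ?_
    by_cases h : indeg G v = j + 1
    · simp [h]; ring
    · by_cases h' : indeg G v = j
      · simp [h']
      · simp [h, h']
  · by_cases h : j = 0
    · simp [h]
    · simp [h]

end DegreeCount

section LimitFreq

variable {a : ℝ}

theorem limitFreq_succ (ha : 0 < a) (j : ℕ) :
    (j + 2 * a + 2) * limitFreq a (j + 1) = (j + a) * limitFreq a j := by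
  have : (0 : ℝ) < j + 2 * a + 2 := by positivity
  rw [limitFreq]
  field_simp

theorem limitFreq_pos (ha : 0 < a) (j : ℕ) : 0 < limitFreq a j := by
  induction j with
  | zero => rw [limitFreq]; positivity
  | succ j ih => rw [limitFreq]; positivity

/-- The left side is nonincreasing in `j`, because `j + 1 + a ≤ j + 2a + 1`, and equality holds at
`j = 0`. -/
theorem limitFreq_le (ha : 0 < a) (j : ℕ) :
    (j + a) * ((j + 2 * a + 1) * limitFreq a j) ≤ a * (a + 1) := by
  induction j with
  | zero =>
    simp only [limitFreq, Nat.cast_zero, zero_add]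
    rw [mul_div_cancel₀ _ (by positivity)]
  | succ j ih =>
    have h := limitFreq_succ ha j
    have h0 := limitFreq_pos ha j
    push_cast
    have : (j + 1 + 2 * a + 1) * limitFreq a (j + 1) = (j + a) * limitFreq a j := by
      rw [← h]; ring
    rw [this]
    calc (j + 1 + a) * ((j + a) * limitFreq a j)
        ≤ (j + 2 * a + 1) * ((j + a) * limitFreq a j) :=
          mul_le_mul_of_nonneg_right (by linarith) (by positivity)
      _ = (j + a) * ((j + 2 * a + 1) * limitFreq a j) := by ring
      _ ≤ _ := ih

/-- The tail `∑_{i ≥ j} i * limitFreq a i` in closed form. -/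
noncomputable def limitTail (a : ℝ) (j : ℕ) : ℝ :=
  (j / a + 1 / (a + 1)) * ((j + 2 * a + 1) * limitFreq a j)

/-- Telescoping: `limitTail` takes the value 1 at 0 and drops by `k * limitFreq a k` at each step.
-/
theorem sum_mul_limitFreq (ha : 0 < a) (k : ℕ) :
    ∑ j ∈ range k, (j : ℝ) * limitFreq a j = 1 - limitTail a k := by
  induction k with
  | zero =>
    have : (2 * a + 1) ≠ 0 := by positivity
    have : (a + 1) ≠ 0 := by positivity
    simp only [limitTail, limitFreq, range_zero, sum_empty, Nat.cast_zero]
    field_simp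
    ring
  | succ k ih =>
    have h := limitFreq_succ ha k
    have : (k + 1 + 2 * a + 1) * limitFreq a (k + 1) = (k + a) * limitFreq a k := by
      rw [← h]; ring
    have : (a + 1) ≠ 0 := by positivity
    rw [Finset.sum_range_succ, ih]
    simp only [limitTail]
    push_cast
    rw [‹(k + 1 + 2 * a + 1) * limitFreq a (k + 1) = _›]
    field_simp
    ring

end LimitFreq

/-! ### Uniform error bound for the indegree counts -/

section DegreeError

variable {a : ℝ} {ha : 0 < a}

theorem denom_eq (ha : 0 < a) (n : ℕ) : denom a n = (a + 1) * (n + a / (a + 1)) := by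
  have : (a + 1) ≠ 0 := by positivity
  unfold denom
  field_simp
  ring

/-- The deviation of `degCount` from its linear approximation. -/
noncomputable def degError (a : ℝ) (ha : 0 < a) (n j : ℕ) : ℝ :=
  degCount a ha n j - (n + a / (a + 1)) * limitFreq a j

/-- The centring `n + a/(a+1)` is `denom a n / (a+1)`, so the linear profile cancels exactly in the
recursion. Only the source terms `∓ a / denom a n` at indegrees 0 and 1 survive. -/
theorem degError_succ_zero (n : ℕ) :
    degError a ha (n + 1) 0 = degError a ha n 0 * (1 - a / denom a n) - a / denom a n := by
  have h1 : (a + 1) ≠ 0 := by positivity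
  have h2 : (2 * a + 1) ≠ 0 := by positivity
  have h3 : (n + a / (a + 1)) ≠ 0 := by positivity
  have h4 : (n + a / (a + 1)) * (a / denom a n) = a / (a + 1) := by
    rw [denom_eq ha]; field_simp
  have h5 : limitFreq a 0 * (1 + a / (a + 1)) = 1 := by
    rw [limitFreq]; field_simp; ring
  unfold degError
  rw [degCount_succ_zero]
  push_cast
  linear_combination -h5 - limitFreq a 0 * h4

theorem degError_succ_succ (n j : ℕ) :
    degError a ha (n + 1) (j + 1) = degError a ha n (j + 1) * (1 - (j + 1 + a) / denom a n)
      + degError a ha n j * ((j + a) / denom a n) + if j = 0 then a / denom a n else 0 := by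
  have h1 : (a + 1) ≠ 0 := by positivity
  have h3 : (n + a / (a + 1)) ≠ 0 := by positivity
  have h4 : (n + a / (a + 1)) * (1 / denom a n) = 1 / (a + 1) := by
    rw [denom_eq ha]; field_simp
  have h5 : limitFreq a (j + 1) * (1 + (j + 1 + a) / (a + 1)) =
      limitFreq a j * ((j + a) / (a + 1)) := by
    have := limitFreq_succ ha j
    field_simp
    linear_combination this
  unfold degError
  rw [degCount_succ_succ]
  push_cast
  linear_combination (-limitFreq a (j + 1) * (j + 1 + a) + limitFreq a j * (j + a)) * h4 - h5

/-- With weight `j + a` the recursion becomes a convex combination of the errors at `j + 1` and `j`,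
so a uniform bound propagates in time as long as the coefficients are nonnegative. -/
theorem degError_bound (ha : 0 < a) : ∃ K : ℝ, 0 < K ∧ ∀ n j : ℕ,
    (j + a) * |degError a ha n j| ≤ K := by
  -- From this time on `a * n ≥ 1`, which gives `j + 1 + a ≤ denom a n` for all `j ≤ n`. Earlier
  -- times are finitely many.
  set n₀ : ℕ := ⌈1 / a⌉₊ with hn₀
  set K : ℝ := 2 * ((n₀ + a) * n₀ + (n₀ + 1) * (a + 1) + a * (a + 1) + a) with hK
  have hKpos : 0 < K := by positivity
  have hlin : ∀ j : ℕ, (j + a) * limitFreq a j ≤ a + 1 := by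
    intro j
    have h := limitFreq_le ha j
    have h0 := limitFreq_pos ha j
    have : a * ((j + a) * limitFreq a j) ≤ a * (a + 1) := by
      refine le_trans ?_ h
      have : a * ((j + a) * limitFreq a j) ≤ (j + 2 * a + 1) * ((j + a) * limitFreq a j) := by
        gcongr
        have : (0 : ℝ) ≤ j := Nat.cast_nonneg j
        linarith
      linarith
    exact le_of_mul_le_mul_left this ha
  have hxle : a / (a + 1) ≤ 1 := by rw [div_le_one (by positivity)]; linarith
  have hsmall : ∀ n j : ℕ, n ≤ n₀ → (j + a) * |degError a ha n j| ≤ K / 2 := by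
    intro n j hn
    have hn' : (n : ℝ) ≤ n₀ := by exact_mod_cast hn
    have h1 : (j + a) * degCount a ha n j ≤ (n₀ + a) * n₀ := by
      rcases lt_or_ge n j with h | h
      · rw [degCount_eq_zero h]; simp; positivity
      · have : (j : ℝ) ≤ n := by exact_mod_cast h
        have h2 : degCount a ha n j ≤ n := degCount_le j
        have h3 : 0 ≤ degCount a ha n j := degCount_nonneg j
        gcongr
        · linarith
        · linarith
    have h2 : (j + a) * ((n + a / (a + 1)) * limitFreq a j) ≤ (n₀ + 1) * (a + 1) := by
      calc _ = (n + a / (a + 1)) * ((j + a) * limitFreq a j) := by ring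
        _ ≤ (n₀ + 1) * (a + 1) := by
          have := limitFreq_pos ha j
          gcongr
          exact hlin j
    have h3 : |degError a ha n j| ≤ degCount a ha n j + (n + a / (a + 1)) * limitFreq a j := by
      have := limitFreq_pos ha j
      have h4 : 0 ≤ degCount a ha n j := degCount_nonneg j
      have h5 : 0 ≤ (n + a / (a + 1)) * limitFreq a j := by positivity
      unfold degError
      rw [abs_le]
      constructor <;> linarith
    calc (j + a) * |degError a ha n j|
        ≤ (j + a) * (degCount a ha n j + (n + a / (a + 1)) * limitFreq a j) := by gcongr
      _ ≤ K / 2 := by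
        rw [mul_add, hK]
        have : 0 < a * (a + 1) := by positivity
        linarith
  -- The halved bound at `j = 0` leaves room for the source term `a` that enters at `j = 1`.
  have key : ∀ n : ℕ, n₀ ≤ n → ∀ j : ℕ,
      (j + a) * |degError a ha n j| ≤ if j = 0 then K / 2 else K := by
    intro n hn
    induction n, hn using Nat.le_induction with
    | base =>
      intro j
      refine (hsmall n₀ j le_rfl).trans ?_
      split_ifs <;> linarith
    | succ n hn ih =>
      have hτ := denom_pos' ha n
      have han : 1 ≤ a * n := by
        have h1 : 1 / a ≤ n := (Nat.le_ceil _).trans (by exact_mod_cast hn)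
        rw [div_le_iff₀ ha] at h1
        linarith
      have hKa : 2 * a ≤ K := by
        rw [hK]
        have : 0 ≤ (n₀ + a) * n₀ + (n₀ + 1) * (a + 1) + a * (a + 1) := by positivity
        linarith
      intro j
      rcases j with _ | j
      · have h0 := ih 0
        simp only [if_true, Nat.cast_zero, zero_add] at h0 ⊢
        rw [degError_succ_zero]
        have hc : 0 ≤ 1 - a / denom a n := by
          rw [sub_nonneg, div_le_one hτ, denom]
          nlinarith
        calc a * |degError a ha n 0 * (1 - a / denom a n) - a / denom a n|
            ≤ a * (|degError a ha n 0| * (1 - a / denom a n) + a / denom a n) := by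
              gcongr
              refine (abs_sub _ _).trans_eq ?_
              rw [abs_mul, abs_of_nonneg hc, abs_of_nonneg (show 0 ≤ a / denom a n by positivity)]
          _ = (a * |degError a ha n 0|) * (1 - a / denom a n) + a * (a / denom a n) := by ring
          _ ≤ K / 2 * (1 - a / denom a n) + K / 2 * (a / denom a n) := by
              gcongr
              linarith
          _ = K / 2 := by ring
      · simp only [Nat.add_eq_zero_iff, one_ne_zero, and_false, if_false]
        rcases le_or_gt j n with hj | hj
        · have hj' : (j : ℝ) ≤ n := by exact_mod_cast hj
          have hc : 0 ≤ 1 - (j + 1 + a) / denom a n := by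
            rw [sub_nonneg, div_le_one hτ, denom]
            nlinarith
          have h1 := ih (j + 1)
          simp only [Nat.add_eq_zero_iff, one_ne_zero, and_false, if_false] at h1
          push_cast at h1 ⊢
          have h2 : (j + a) * |degError a ha n j| + (if j = 0 then a else 0) ≤ K := by
            have := ih j
            split_ifs at this ⊢ <;> linarith
          have h3 : |degError a ha (n + 1) (j + 1)| ≤
              |degError a ha n (j + 1)| * (1 - (j + 1 + a) / denom a n)
              + ((j + a) * |degError a ha n j| + (if j = 0 then a else 0)) * (1 / denom a n) := by
            rw [degError_succ_succ]
            refine (abs_add_le _ _).trans ?_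
            have h4 : |degError a ha n (j + 1) * (1 - (j + 1 + a) / denom a n)
                + degError a ha n j * ((j + a) / denom a n)| ≤
                |degError a ha n (j + 1)| * (1 - (j + 1 + a) / denom a n)
                + |degError a ha n j| * ((j + a) / denom a n) := by
              refine (abs_add_le _ _).trans_eq ?_
              rw [abs_mul, abs_mul, abs_of_nonneg hc,
                abs_of_nonneg (show 0 ≤ (j + a) / denom a n by positivity)]
            have h5 : |if j = 0 then a / denom a n else 0| =
                (if j = 0 then a else 0) * (1 / denom a n) := by
              split_ifs
              · rw [abs_of_nonneg (by positivity)]; ring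
              · simp
            rw [h5]
            refine (add_le_add_left h4 _).trans_eq ?_
            ring
          calc (j + 1 + a) * |degError a ha (n + 1) (j + 1)|
              ≤ (j + 1 + a) * (|degError a ha n (j + 1)| * (1 - (j + 1 + a) / denom a n)
                + K * (1 / denom a n)) := by
                refine mul_le_mul_of_nonneg_left (h3.trans ?_) (by positivity)
                gcongr
            _ = ((j + 1 + a) * |degError a ha n (j + 1)|) * (1 - (j + 1 + a) / denom a n)
                + K * ((j + 1 + a) / denom a n) := by ring
            _ ≤ K * (1 - (j + 1 + a) / denom a n) + K * ((j + 1 + a) / denom a n) := by gcongr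
            _ = K := by ring
        -- No vertex can have this indegree yet, so the error is just the linear profile, controlled
        -- by `limitFreq_le`.
        · have h0 := limitFreq_pos ha (j + 1)
          have h1 := limitFreq_le ha (j + 1)
          have hj' : (n : ℝ) + 1 ≤ j := by exact_mod_cast hj
          rw [degError, degCount_eq_zero (by omega), zero_sub, abs_neg, abs_of_nonneg (by positivity)]
          push_cast at h1 ⊢
          calc (j + 1 + a) * ((n + 1 + a / (a + 1)) * limitFreq a (j + 1))
              ≤ (j + 1 + a) * ((j + 1 + 2 * a + 1) * limitFreq a (j + 1)) := by
                refine mul_le_mul_of_nonneg_left (mul_le_mul_of_nonneg_right ?_ h0.le) (by positivity)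
                linarith
            _ ≤ a * (a + 1) := h1
            _ ≤ K := by
              rw [hK]
              have : 0 ≤ (n₀ + a) * n₀ + (n₀ + 1) * (a + 1) + a := by positivity
              have : 0 < a * (a + 1) := by positivity
              linarith
  refine ⟨K, hKpos, fun n j => ?_⟩
  rcases le_total n n₀ with h | h
  · exact (hsmall n j h).trans (by linarith)
  · refine (key n h j).trans ?_
    split_ifs <;> linarith

end DegreeError

/-! ### One-step transitions of parent degree, indegree and grandchildren -/

/-- The number of edges sent to the vertices that send their edge to `t`. -/
def grandDeg {n : ℕ} (G : Graph n) (t : Fin n) : ℕ := #{e : Fin n | target G (target G e) = t}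

/-- The indegree of the vertex to which `t` sends its edge. -/
def parentDeg {n : ℕ} (G : Graph n) (t : Fin n) : ℕ := indeg G (target G t)

section Transition

variable {n : ℕ}

theorem parentDeg_addVertex (G : Graph n) (t : Fin n) (s : Fin (n + 1)) :
    parentDeg (addVertex G s) t.castSucc =
      parentDeg G t + if s = (target G t).castSucc then 1 else 0 := by
  unfold parentDeg
  rw [target_addVertex_castSucc, indeg_addVertex_castSucc]

theorem grandDeg_addVertex (G : Graph n) (t : Fin n) (s : Fin (n + 1)) :
    grandDeg (addVertex G s) t.castSucc =
      grandDeg G t + if target (addVertex G s) s = t.castSucc then 1 else 0 := by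
  unfold grandDeg
  simp only [Finset.card_filter, Fin.sum_univ_castSucc, target_addVertex_castSucc,
    target_addVertex_last, Fin.castSucc_inj]

theorem sum_indeg_children (G : Graph n) (t : Fin n) :
    ∑ v, (indeg G v : ℝ) * (if target G v = t then 1 else 0) = grandDeg G t := by
  rw [sum_indeg_mul, grandDeg, Finset.card_filter]
  push_cast
  rfl

/-- The new edge can hit the parent of `t`, or `t`, or a child of `t`; without a loop at `t` these
are disjoint, and each raises exactly one of the three statistics by one. -/
theorem sum_attachProb_local {a : ℝ} (ha : 0 < a) (G : Graph n) (t : Fin n) (ht : target G t ≠ t)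
    (F : ℕ → ℕ → ℕ → ℝ) :
    ∑ s, attachProb a G s * F (parentDeg (addVertex G s) t.castSucc)
        (indeg (addVertex G s) t.castSucc) (grandDeg (addVertex G s) t.castSucc) =
      F (parentDeg G t) (indeg G t) (grandDeg G t)
      + (parentDeg G t + a) / denom a n *
        (F (parentDeg G t + 1) (indeg G t) (grandDeg G t)
          - F (parentDeg G t) (indeg G t) (grandDeg G t))
      + (indeg G t + a) / denom a n *
        (F (parentDeg G t) (indeg G t + 1) (grandDeg G t)
          - F (parentDeg G t) (indeg G t) (grandDeg G t))
      + (grandDeg G t + a * indeg G t) / denom a n *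
        (F (parentDeg G t) (indeg G t) (grandDeg G t + 1)
          - F (parentDeg G t) (indeg G t) (grandDeg G t)) := by
  set X := parentDeg G t
  set l := indeg G t
  set W := grandDeg G t
  set f := F X l W
  have hinc : ∀ s, attachProb a G s * F (parentDeg (addVertex G s) t.castSucc)
        (indeg (addVertex G s) t.castSucc) (grandDeg (addVertex G s) t.castSucc) =
      attachProb a G s * f + attachProb a G s * (F (parentDeg (addVertex G s) t.castSucc)
        (indeg (addVertex G s) t.castSucc) (grandDeg (addVertex G s) t.castSucc) - f) :=
    fun s => by ring
  rw [Finset.sum_congr rfl fun s _ => hinc s, Finset.sum_add_distrib, ← Finset.sum_mul,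
    sum_attachProb ha G, one_mul, sum_attachProb_mul]
  have hlast : F (parentDeg (addVertex G (Fin.last n)) t.castSucc)
        (indeg (addVertex G (Fin.last n)) t.castSucc)
        (grandDeg (addVertex G (Fin.last n)) t.castSucc) = f := by
    rw [parentDeg_addVertex, indeg_addVertex_castSucc, grandDeg_addVertex, target_addVertex_last,
      if_neg (Fin.castSucc_ne_last _).symm, if_neg (Fin.castSucc_ne_last _).symm]
    rfl
  -- Targets never exceed their sources, so the parent of `t` is not also its child.
  have hparent : target G (target G t) ≠ t := fun h =>
    ht (le_antisymm (target_le G t) (h.symm.le.trans (target_le G (target G t))))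
  have hcast : ∀ v : Fin n, F (parentDeg (addVertex G v.castSucc) t.castSucc)
        (indeg (addVertex G v.castSucc) t.castSucc)
        (grandDeg (addVertex G v.castSucc) t.castSucc) - f =
      (if v = target G t then F (X + 1) l W - f else 0) + (if v = t then F X (l + 1) W - f else 0)
        + (if target G v = t then 1 else 0) * (F X l (W + 1) - f) := by
    intro v
    rw [parentDeg_addVertex, indeg_addVertex_castSucc, grandDeg_addVertex,
      target_addVertex_castSucc]
    simp only [Fin.castSucc_inj]
    by_cases h1 : v = target G t
    · subst h1
      rw [if_pos rfl, if_neg ht, if_neg hparent, if_pos rfl, if_neg ht, if_neg hparent]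
      simp [X, l, W]
    · by_cases h2 : v = t
      · subst h2
        rw [if_neg h1, if_pos rfl, if_neg ht, if_neg h1, if_pos rfl, if_neg ht]
        simp [X, l, W]
      · rw [if_neg h1, if_neg h2, if_neg h1, if_neg h2]
        split_ifs <;> simp [X, l, W, f]
  have hC : ∑ v : Fin n, (indeg G v + a) / denom a n * (if target G v = t then (1 : ℝ) else 0) =
      (W + a * l) / denom a n := by
    have h1 := sum_indeg_children G t
    have h2 : ∑ v : Fin n, (if target G v = t then (1 : ℝ) else 0) = l := by
      simp only [l, indeg, Finset.card_filter]
      push_cast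
      rfl
    rw [← h1, ← h2, Finset.mul_sum, ← Finset.sum_add_distrib, Finset.sum_div]
    exact Finset.sum_congr rfl fun v _ => by ring
  simp only [hlast, hcast, sub_self, mul_zero, add_zero, mul_add, Finset.sum_add_distrib, mul_ite,
    Finset.sum_ite_eq', Finset.mem_univ, if_true, ← mul_assoc]
  rw [← Finset.sum_mul]
  simp only [mul_ite, mul_zero] at hC
  rw [hC]
  simp only [X, l, parentDeg]
  ring

end Transition

/-! ### Rising products as test functions -/

section RisingProduct

/-- The product `y (y + S) ⋯ (y + (m - 1) S)`. -/
noncomputable def rising (S : ℝ) (m : ℕ) (y : ℝ) : ℝ := ∏ i ∈ range m, (y + i * S)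

variable {S y j : ℝ} {m : ℕ}

theorem rising_nonneg (hS : 0 ≤ S) (hy : 0 ≤ y) : 0 ≤ rising S m y :=
  Finset.prod_nonneg fun i _ => by positivity

theorem rising_self_mul (c : ℝ) : rising S m (c * S) = S ^ m * ∏ i ∈ range m, (c + i) := by
  unfold rising
  rw [← Finset.card_range m, ← Finset.prod_const, Finset.card_range, ← Finset.prod_mul_distrib]
  exact Finset.prod_congr rfl fun i _ => by ring

theorem pow_le_rising (hS : 0 ≤ S) (hy : 0 ≤ y) : y ^ m ≤ rising S m y := by
  unfold rising
  rw [← Finset.card_range m, ← Finset.prod_const, Finset.card_range]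
  exact Finset.prod_le_prod (fun _ _ => hy) fun i _ => by
    have : 0 ≤ i * S := by positivity
    linarith

/-- A first-order upper bound without higher-order terms. This is why a rising product replaces the
plain power: the gaps `S` absorb the second-order terms of any increment `j ≤ S`. -/
theorem rising_add_le (hy : 0 < y) (hj : 0 ≤ j) (hjS : j ≤ S) :
    rising S m (y + j) ≤ rising S m y * (1 + m * j / y) := by
  induction m with
  | zero => simp [rising]
  | succ m ih =>
    have hS : 0 ≤ S := hj.trans hjS
    unfold rising at ih ⊢
    rw [Finset.prod_range_succ, Finset.prod_range_succ]
    have h0 : 0 ≤ ∏ i ∈ range m, (y + i * S) := rising_nonneg hS hy.le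
    calc (∏ i ∈ range m, (y + j + i * S)) * (y + j + m * S)
        ≤ (∏ i ∈ range m, (y + i * S)) * (1 + m * j / y) * (y + j + m * S) := by gcongr
      _ = (∏ i ∈ range m, (y + i * S)) * ((1 + m * j / y) * (y + j + m * S)) := by ring
      _ ≤ (∏ i ∈ range m, (y + i * S)) * ((y + m * S) * (1 + (m + 1 : ℕ) * j / y)) := by
        refine mul_le_mul_of_nonneg_left ?_ h0
        have h1 : (y + m * S) * (1 + (m + 1 : ℕ) * j / y) - (1 + m * j / y) * (y + j + m * S)
            = m * j * (S - j) / y := by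
          push_cast
          field_simp
          ring
        have h2 : 0 ≤ m * j * (S - j) / y := by
          have : 0 ≤ S - j := by linarith
          positivity
        linarith
      _ = _ := by ring

/-- Only the first factor is enlarged; the others are merely compared. -/
theorem le_rising_add (hm : m ≠ 0) (hS : 0 ≤ S) (hy : 0 < y) (hj : 0 ≤ j) :
    rising S m y * (1 + j / y) ≤ rising S m (y + j) := by
  obtain ⟨m, rfl⟩ := Nat.exists_eq_succ_of_ne_zero hm
  unfold rising
  rw [Finset.prod_range_succ', Finset.prod_range_succ']
  simp only [Nat.cast_zero, zero_mul, add_zero]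
  have h1 : ∏ i ∈ range m, (y + (i + 1 : ℕ) * S) ≤ ∏ i ∈ range m, (y + j + (i + 1 : ℕ) * S) :=
    Finset.prod_le_prod (fun i _ => by positivity) fun i _ => by linarith
  calc (∏ i ∈ range m, (y + (i + 1 : ℕ) * S)) * y * (1 + j / y)
      = (∏ i ∈ range m, (y + (i + 1 : ℕ) * S)) * (y + j) := by
        rw [mul_assoc, mul_add, mul_one, mul_div_cancel₀ _ hy.ne']
    _ ≤ _ := by gcongr

/-- With `y = W + s l + a S`, the expected increment of `y` from hits on `t` and its children is at
most `(y + a l) / τ`: the shift `a S` absorbs the term `s a`. The part `y` gives the factor `m / τ`.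
The part `a l` is paid for by raising the weight of `l` from `s` to `s + m (2a+1) / τ`; `hκ` ensures
that this suffices even though `h₀` is multiplied only by `1 - (X + a) / τ`. -/
theorem rising_step {a X l W s τ h₀ h₁ : ℝ} (ha : 0 < a) (hX : 0 ≤ X) (hl : 0 ≤ l) (hW : 0 ≤ W)
    (hS : 1 ≤ S) (hs : 0 ≤ s) (hsS : s ≤ S) (hτ : 0 < τ) (hh₀ : 0 ≤ h₀) (hh₁ : 0 ≤ h₁)
    (hκ : a ≤ (1 - (X + a) / τ) * (2 * a + 1)) :
    h₀ * rising S m (W + s * l + a * S)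
      + (X + a) / τ * (h₁ * rising S m (W + s * l + a * S) - h₀ * rising S m (W + s * l + a * S))
      + (l + a) / τ *
        (h₀ * rising S m (W + s * (l + 1) + a * S) - h₀ * rising S m (W + s * l + a * S))
      + (W + a * l) / τ *
        (h₀ * rising S m (W + 1 + s * l + a * S) - h₀ * rising S m (W + s * l + a * S)) ≤
    rising S m (W + (s + m * (2 * a + 1) / τ) * l + a * S) *
      (h₀ * (1 - (X + a) / τ + m / τ) + h₁ * ((X + a) / τ)) := by
  rcases eq_or_ne m 0 with rfl | hm
  · simp [rising]
    linarith
  set y := W + s * l + a * S with hy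
  have hypos : 0 < y := by positivity
  set r := rising S m y with hr
  have hr0 : 0 ≤ r := rising_nonneg (by linarith) hypos.le
  have h1 : rising S m (W + s * (l + 1) + a * S) ≤ r * (1 + m * s / y) := by
    rw [show W + s * (l + 1) + a * S = y + s by rw [hy]; ring]
    exact rising_add_le hypos hs hsS
  have h2 : rising S m (W + 1 + s * l + a * S) ≤ r * (1 + m * 1 / y) := by
    rw [show W + 1 + s * l + a * S = y + 1 by rw [hy]; ring]
    exact rising_add_le hypos zero_le_one hS
  have h3 : r * (1 + m * (2 * a + 1) / τ * l / y) ≤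
      rising S m (W + (s + m * (2 * a + 1) / τ) * l + a * S) := by
    rw [show W + (s + m * (2 * a + 1) / τ) * l + a * S = y + m * (2 * a + 1) / τ * l by
      rw [hy]; ring]
    exact le_rising_add hm (by linarith) hypos (by positivity)
  have hκ0 : 0 ≤ 1 - (X + a) / τ := by
    have : 0 < 2 * a + 1 := by positivity
    exact nonneg_of_mul_nonneg_left (ha.le.trans hκ) this
  calc _ ≤ h₀ * r + (X + a) / τ * (h₁ * r - h₀ * r)
      + (l + a) / τ * (h₀ * (r * (1 + m * s / y)) - h₀ * r)
      + (W + a * l) / τ * (h₀ * (r * (1 + m * 1 / y)) - h₀ * r) := by gcongr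
    _ = r * (h₀ * (1 - (X + a) / τ) + h₁ * ((X + a) / τ)) +
        h₀ * r * (m / (τ * y)) * (s * (l + a) + W + a * l) := by
      field_simp
      ring
    _ ≤ r * (h₀ * (1 - (X + a) / τ) + h₁ * ((X + a) / τ)) +
        h₀ * r * (m / (τ * y)) * (y + a * l) := by
      gcongr
      have : s * a ≤ a * S := by rw [mul_comm]; gcongr
      rw [hy]
      linarith
    _ = r * (h₀ * (1 - (X + a) / τ + m / τ) + h₁ * ((X + a) / τ)) +
        h₀ * r * (m / (τ * y)) * l * a := by
      field_simp
      ring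
    _ ≤ r * (h₀ * (1 - (X + a) / τ + m / τ) + h₁ * ((X + a) / τ)) +
        h₀ * r * (m / (τ * y)) * l * ((1 - (X + a) / τ) * (2 * a + 1)) := by gcongr
    _ ≤ r * (h₀ * (1 - (X + a) / τ + m / τ) + h₁ * ((X + a) / τ)) +
        (h₀ * r * (m / (τ * y)) * l * ((1 - (X + a) / τ) * (2 * a + 1)) +
          r * (m * (2 * a + 1) / τ * l / y) * (h₀ * (m / τ) + h₁ * ((X + a) / τ))) := by
      gcongr
      refine le_add_of_nonneg_right ?_
      positivity
    _ = r * (1 + m * (2 * a + 1) / τ * l / y) *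
        (h₀ * (1 - (X + a) / τ + m / τ) + h₁ * ((X + a) / τ)) := by
      field_simp
      ring
    _ ≤ _ := by
      gcongr

end RisingProduct

/-! ### Weighted moments and their evolution in time -/

section Moments

variable {a : ℝ} {ha : 0 < a} {n : ℕ}

/-- The expectation of `h (parentDeg t)` times a rising product in the linear functional
`grandDeg t + s * indeg t` over the event that `t` has no loop. -/
noncomputable def weightedMoment (a : ℝ) (ha : 0 < a) (n : ℕ) (t : Fin n) (h : ℕ → ℝ) (m : ℕ)
    (S s : ℝ) : ℝ :=
  expect a ha n fun G => if target G t = t then 0 else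
    h (parentDeg G t) * rising S m (grandDeg G t + s * indeg G t + a * S)

theorem weightedMoment_add {t : Fin n} {h h' : ℕ → ℝ} {m : ℕ} {S s : ℝ} :
    weightedMoment a ha n t (fun x => h x + h' x) m S s =
      weightedMoment a ha n t h m S s + weightedMoment a ha n t h' m S s := by
  unfold weightedMoment
  rw [← expect_add]
  congr 1
  funext G
  split_ifs <;> ring

theorem weightedMoment_const_mul {t : Fin n} {h : ℕ → ℝ} {m : ℕ} {S s : ℝ} (c : ℝ) :
    weightedMoment a ha n t (fun x => c * h x) m S s = c * weightedMoment a ha n t h m S s := by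
  unfold weightedMoment
  rw [← expect_const_mul]
  congr 1
  funext G
  split_ifs <;> ring

theorem weightedMoment_succ_le (t : Fin n) {h : ℕ → ℝ} (hh : ∀ x, 0 ≤ h x) (m : ℕ) {S s : ℝ}
    (hS : 1 ≤ S) (hs : 0 ≤ s) (hsS : s ≤ S) :
    weightedMoment a ha (n + 1) t.castSucc h m S s ≤
      weightedMoment a ha n t (fun x => h x * (1 - (x + a) / denom a n + m / denom a n)
        + h (x + 1) * ((x + a) / denom a n)) m S (s + m * (2 * a + 1) / denom a n) := by
  unfold weightedMoment
  rw [expect_succ]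
  refine expect_mono fun G => ?_
  simp only [target_addVertex_castSucc, Fin.castSucc_inj]
  split_ifs with ht
  · simp
  · rw [sum_attachProb_local ha G t ht fun x l w => h x * rising S m (w + s * l + a * S)]
    have hτ := denom_pos' ha n
    have hX : (parentDeg G t : ℝ) ≤ n := by exact_mod_cast indeg_le G _
    have hn : (1 : ℝ) ≤ n := by exact_mod_cast t.pos
    -- The worst case is `parentDeg = n`, where the bracket equals `a * n / denom a n`; the claim
    -- then reduces to `n ≥ 1`.
    have hκ : a ≤ (1 - (parentDeg G t + a) / denom a n) * (2 * a + 1) := by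
      have h1 : (parentDeg G t + a) / denom a n ≤ (n + a) / denom a n := by gcongr
      have h2 : a ≤ (1 - (n + a) / denom a n) * (2 * a + 1) := by
        have : 1 - (n + a) / denom a n = a * n / denom a n := by
          rw [eq_div_iff hτ.ne', sub_mul, div_mul_cancel₀ _ hτ.ne', denom]
          ring
        rw [this, div_mul_eq_mul_div, le_div_iff₀ hτ, denom]
        nlinarith [mul_le_mul_of_nonneg_left hn ha.le]
      refine h2.trans ?_
      gcongr
    have := rising_step (m := m) ha (Nat.cast_nonneg (parentDeg G t)) (Nat.cast_nonneg (indeg G t))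
      (Nat.cast_nonneg (grandDeg G t)) hS hs hsS hτ (hh (parentDeg G t)) (hh (parentDeg G t + 1)) hκ
    push_cast
    refine this.trans_eq ?_
    ring

end Moments

/-- The logarithmic time elapsed between the arrival of `t` and the time `n`. -/
noncomputable def logTime (a : ℝ) (t n : ℕ) : ℝ := ∑ i ∈ Ico (t + 1) n, 1 / denom a i

section Moments

variable {a : ℝ} {ha : 0 < a}

theorem logTime_nonneg (ha : 0 < a) (t n : ℕ) : 0 ≤ logTime a t n :=
  Finset.sum_nonneg fun i _ => by have := denom_pos' ha i; positivity

theorem logTime_succ {t n : ℕ} (h : t + 1 ≤ n) :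
    logTime a t (n + 1) = logTime a t n + 1 / denom a n :=
  Finset.sum_Ico_succ_top h _

/-- A loopless newborn has no children or grandchildren, so the rising product is deterministic; its
parent has just gained one indegree. -/
theorem weightedMoment_birth (ha : 0 < a) (t : ℕ) (h : ℕ → ℝ) (m : ℕ) (S s : ℝ) :
    weightedMoment a ha (t + 1) (Fin.last t) h m S s =
      rising S m (a * S) * expect a ha t fun G =>
        ∑ v, (indeg G v + a) / denom a t * h (indeg G v + 1) := by
  unfold weightedMoment
  rw [expect_succ, ← expect_const_mul]
  congr 1
  funext G
  rw [sum_attachProb_mul, target_addVertex_last, if_pos rfl, mul_zero, add_zero, Finset.mul_sum]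
  refine Finset.sum_congr rfl fun v _ => ?_
  have h1 : grandDeg (addVertex G v.castSucc) (Fin.last t) = 0 := by
    unfold grandDeg
    rw [Finset.card_eq_zero, Finset.filter_eq_empty_iff]
    intro e _ he
    have h2 : target (addVertex G v.castSucc) e = Fin.last t :=
      le_antisymm (Fin.le_last _) (he.symm.le.trans (target_le _ _))
    rw [h2, target_addVertex_last] at he
    exact Fin.castSucc_ne_last v he
  have h2 : parentDeg (addVertex G v.castSucc) (Fin.last t) = indeg G v + 1 := by
    rw [parentDeg, target_addVertex_last, indeg_addVertex_castSucc, if_pos rfl]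
  rw [target_addVertex_last, if_neg (Fin.castSucc_ne_last v), h1, h2, indeg_addVertex_last,
    if_neg (Fin.castSucc_ne_last v)]
  simp
  ring

/-- A multiple of the limiting distribution of the indegree of the parent of a new vertex. -/
noncomputable def parentFreq (a : ℝ) (z : ℕ) : ℝ := (z + 2 * a + 1) * limitFreq a z

theorem parentFreq_pos (ha : 0 < a) (z : ℕ) : 0 < parentFreq a z := by
  have := limitFreq_pos ha z
  unfold parentFreq
  positivity

theorem parentFreq_succ (ha : 0 < a) (z : ℕ) : parentFreq a (z + 1) = (z + a) * limitFreq a z := by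
  rw [← limitFreq_succ ha, parentFreq]
  push_cast
  ring

/-- This makes `parentFreq` an eigenvector, with eigenvalue `a`, of the growth of the parent's
indegree; see `weightedMoment_indicator_le`. -/
theorem parentFreq_rec (ha : 0 < a) (z : ℕ) :
    (z + 1 + 2 * a) * parentFreq a (z + 1) = (z + a) * parentFreq a z := by
  rw [parentFreq_succ ha, parentFreq]
  ring

theorem weightedMoment_birth_one_le (ha : 0 < a) (t m : ℕ) {S : ℝ} (hS : 0 ≤ S) (s : ℝ) :
    weightedMoment a ha (t + 1) (Fin.last t) (fun _ => 1) m S s ≤ rising S m (a * S) := by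
  rw [weightedMoment_birth]
  refine mul_le_of_le_one_right (rising_nonneg hS (by positivity)) ?_
  refine (expect_mono fun G => ?_).trans_eq (expect_const (a := a) (ha := ha) (n := t) 1)
  have h := sum_attachProb_mul (a := a) G (fun _ => 1)
  simp only [mul_one, sum_attachProb ha G] at h ⊢
  have : 0 ≤ a / denom a t := by have := denom_pos' ha t; positivity
  linarith

/-- The new vertex picks a parent of indegree `z` with probability proportional to `(z + a) *
degCount`; the weight in `degError_bound` is just what makes the error `K / denom a t`. -/
theorem weightedMoment_birth_indicator_le (ha : 0 < a) {K : ℝ}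
    (hK : ∀ n j : ℕ, (j + a) * |degError a ha n j| ≤ K) (t m z : ℕ) {S : ℝ} (hS : 0 ≤ S) (s : ℝ) :
    weightedMoment a ha (t + 1) (Fin.last t) (fun x => if x = z + 1 then 1 else 0) m S s ≤
      rising S m (a * S) * (parentFreq a (z + 1) + K / denom a t) := by
  rw [weightedMoment_birth]
  refine mul_le_mul_of_nonneg_left ?_ (rising_nonneg hS (by positivity))
  have hτ := denom_pos' ha t
  have h1 : (expect a ha t fun G => ∑ v, (indeg G v + a) / denom a t *
      (if indeg G v + 1 = z + 1 then (1 : ℝ) else 0)) = (z + a) / denom a t * degCount a ha t z := by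
    rw [degCount, ← expect_const_mul]
    congr 1
    funext G
    rw [Finset.mul_sum]
    refine Finset.sum_congr rfl fun v _ => ?_
    by_cases hv : indeg G v = z
    · simp [hv]
    · simp [hv]
  rw [h1]
  have h2 : degCount a ha t z = degError a ha t z + (t + a / (a + 1)) * limitFreq a z := by
    unfold degError; ring
  have h3 : (z + a) * degError a ha t z ≤ K :=
    le_trans (mul_le_mul_of_nonneg_left (le_abs_self _) (by positivity)) (hK t z)
  have h4 : (z + a) / denom a t * ((t + a / (a + 1)) * limitFreq a z) =
      parentFreq a (z + 1) / (a + 1) := by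
    rw [parentFreq_succ ha, denom_eq ha]
    field_simp
  have h5 : parentFreq a (z + 1) / (a + 1) ≤ parentFreq a (z + 1) :=
    div_le_self (parentFreq_pos ha _).le (by linarith)
  calc (z + a) / denom a t * degCount a ha t z
      = (z + a) / denom a t * ((t + a / (a + 1)) * limitFreq a z)
        + ((z + a) * degError a ha t z) / denom a t := by rw [h2]; ring
    _ ≤ parentFreq a (z + 1) + K / denom a t := by rw [h4]; gcongr

theorem one_le_parentDeg {n : ℕ} (G : Graph n) (t : Fin n) : 1 ≤ parentDeg G t := by
  unfold parentDeg indeg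
  exact Finset.card_pos.2 ⟨t, by simp⟩

theorem weightedMoment_indicator_zero {n : ℕ} (t : Fin n) (m : ℕ) (S s : ℝ) :
    weightedMoment a ha n t (fun x => if x = 0 then 1 else 0) m S s = 0 := by
  unfold weightedMoment
  refine Eq.trans ?_ (expect_const (a := a) (ha := ha) (n := n) 0)
  congr 1
  funext G
  have := one_le_parentDeg G t
  beta_reduce
  rw [if_neg (show ¬ parentDeg G t = 0 by omega)]
  simp

theorem weightedMoment_indicator_eq_zero {n z : ℕ} (h : n < z) (t : Fin n) (m : ℕ) (S s : ℝ) :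
    weightedMoment a ha n t (fun x => if x = z then 1 else 0) m S s = 0 := by
  unfold weightedMoment
  refine Eq.trans ?_ (expect_const (a := a) (ha := ha) (n := n) 0)
  congr 1
  funext G
  have : parentDeg G t ≤ n := indeg_le _ _
  beta_reduce
  rw [if_neg (show ¬ parentDeg G t = z by omega)]
  simp

/-- The weight of `indeg t` at time `n` in the linear functional used up to time `N`. -/
noncomputable def dualWeight (a : ℝ) (m n N : ℕ) : ℝ :=
  1 + m * (2 * a + 1) * ∑ i ∈ Ico n N, 1 / denom a i

theorem dualWeight_eq_add {m n N : ℕ} (h : n < N) :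
    dualWeight a m n N = dualWeight a m (n + 1) N + m * (2 * a + 1) / denom a n := by
  unfold dualWeight
  rw [Finset.sum_eq_sum_Ico_succ_bot h]
  ring

theorem one_le_dualWeight (ha : 0 < a) (m n N : ℕ) : 1 ≤ dualWeight a m n N := by
  have h : 0 ≤ ∑ i ∈ Ico n N, 1 / denom a i := Finset.sum_nonneg fun i _ => by
    have := denom_pos' ha i
    positivity
  have : 0 ≤ m * (2 * a + 1) * ∑ i ∈ Ico n N, 1 / denom a i := by positivity
  unfold dualWeight
  linarith

theorem dualWeight_anti (ha : 0 < a) (m N : ℕ) {n n' : ℕ} (h : n ≤ n') :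
    dualWeight a m n' N ≤ dualWeight a m n N := by
  have h1 : ∑ i ∈ Ico n' N, 1 / denom a i ≤ ∑ i ∈ Ico n N, 1 / denom a i :=
    Finset.sum_le_sum_of_subset_of_nonneg (Finset.Ico_subset_Ico_left h) fun i _ _ => by
      have := denom_pos' ha i
      positivity
  unfold dualWeight
  gcongr

/-- Each step multiplies the moment by at most `1 + m / denom a n` while `dualWeight` follows the
change of `s` required by `weightedMoment_succ_le`. The gap `S` stays at the initial, largest
weight. -/
theorem weightedMoment_one_le (ha : 0 < a) (m t N n : ℕ) (htn : t + 1 ≤ n) (hnN : n ≤ N) :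
    weightedMoment a ha n ⟨t, htn⟩ (fun _ => 1) m (dualWeight a m (t + 1) N) (dualWeight a m n N) ≤
      rising (dualWeight a m (t + 1) N) m (a * dualWeight a m (t + 1) N) *
        Real.exp (m * logTime a t n) := by
  set S := dualWeight a m (t + 1) N with hSdef
  have hS : 1 ≤ S := one_le_dualWeight ha _ _ _
  induction n, htn using Nat.le_induction with
  | base =>
    refine (weightedMoment_birth_one_le ha t m (by linarith) _).trans_eq ?_
    simp [logTime]
  | succ n htn ih =>
    have hτ := denom_pos' ha n
    have h1 := weightedMoment_succ_le (ha := ha) (⟨t, htn⟩ : Fin n) (h := fun _ => 1)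
      (fun _ => zero_le_one) m hS (zero_le_one.trans (one_le_dualWeight ha m (n + 1) N))
      (dualWeight_anti ha m N (by omega))
    rw [← dualWeight_eq_add (by omega : n < N)] at h1
    have h2 : weightedMoment a ha n ⟨t, htn⟩ (fun x => (1 : ℝ) * (1 - (x + a) / denom a n +
        m / denom a n) + 1 * ((x + a) / denom a n)) m S (dualWeight a m n N) =
        (1 + m / denom a n) * weightedMoment a ha n ⟨t, htn⟩ (fun _ => 1) m S
          (dualWeight a m n N) := by
      rw [← weightedMoment_const_mul]
      congr 1
      funext x
      ring
    refine h1.trans (h2.le.trans ?_)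
    have h3 := ih (by omega)
    have h4 : 1 + m / denom a n ≤ Real.exp (m * (1 / denom a n)) := by
      have := Real.add_one_le_exp (m * (1 / denom a n))
      rw [mul_one_div] at this ⊢
      linarith
    have hr : 0 ≤ rising S m (a * S) := rising_nonneg (by linarith) (by positivity)
    calc _ ≤ (1 + m / denom a n) * (rising S m (a * S) * Real.exp (m * logTime a t n)) := by
          gcongr
      _ ≤ Real.exp (m * (1 / denom a n)) *
          (rising S m (a * S) * Real.exp (m * logTime a t n)) := by gcongr
      _ = _ := by
        rw [logTime_succ htn, mul_add, Real.exp_add]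
        ring

/-- Induction on time, for all `z` at once. The profile `parentFreq` grows by `1 + (a + m) / denom a
n` per step and the constant profile by `1 + (m - 1) / denom a n`, whence the two exponentials. -/
theorem weightedMoment_indicator_le (ha : 0 < a) {K : ℝ}
    (hK : ∀ n j : ℕ, (j + a) * |degError a ha n j| ≤ K) (m t N n : ℕ) (hat : 1 ≤ a * t)
    (htn : t + 1 ≤ n) (hnN : n ≤ N) (z : ℕ) :
    weightedMoment a ha n ⟨t, htn⟩ (fun x => if x = z then 1 else 0) m (dualWeight a m (t + 1) N)
        (dualWeight a m n N) ≤
      rising (dualWeight a m (t + 1) N) m (a * dualWeight a m (t + 1) N) *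
        (parentFreq a z * Real.exp ((a + m) * logTime a t n)
          + K / denom a t * Real.exp ((m - 1) * logTime a t n)) := by
  set S := dualWeight a m (t + 1) N with hSdef
  have hS : 1 ≤ S := one_le_dualWeight ha _ _ _
  have hr : 0 ≤ rising S m (a * S) := rising_nonneg (by linarith) (by positivity)
  have hK0 : 0 ≤ K := le_trans (by positivity) (hK 0 0)
  have hτt := denom_pos' ha t
  have hU : ∀ (z n : ℕ), 0 ≤ rising S m (a * S) *
        (parentFreq a z * Real.exp ((a + m) * logTime a t n)
          + K / denom a t * Real.exp ((m - 1) * logTime a t n)) := by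
    intro z n
    have := parentFreq_pos ha z
    positivity
  induction n, htn using Nat.le_induction generalizing z with
  | base =>
    rcases z with _ | z
    · rw [weightedMoment_indicator_zero]
      exact hU 0 _
    · refine (weightedMoment_birth_indicator_le ha hK t m z (by linarith) _).trans_eq ?_
      simp [logTime]
  | succ n htn ih =>
    rcases z with _ | z
    · rw [weightedMoment_indicator_zero]
      exact hU 0 _
    rcases lt_or_ge (n + 1) (z + 1) with hz | hz
    · rw [weightedMoment_indicator_eq_zero hz]
      exact hU _ _
    have hτ := denom_pos' ha n
    have h1 := weightedMoment_succ_le (ha := ha) (⟨t, htn⟩ : Fin n)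
      (h := fun x => if x = z + 1 then 1 else 0)
      (fun _ => by split_ifs <;> norm_num) m hS
      (zero_le_one.trans (one_le_dualWeight ha m (n + 1) N))
      (dualWeight_anti ha m N (by omega))
    rw [← dualWeight_eq_add (by omega : n < N)] at h1
    have h2 : weightedMoment a ha n ⟨t, htn⟩ (fun x => (if x = z + 1 then (1 : ℝ) else 0) *
        (1 - (x + a) / denom a n + m / denom a n) +
        (if x + 1 = z + 1 then 1 else 0) * ((x + a) / denom a n)) m S (dualWeight a m n N) =
        (1 - (z + 1 + a) / denom a n + m / denom a n) * weightedMoment a ha n ⟨t, htn⟩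
          (fun x => if x = z + 1 then 1 else 0) m S (dualWeight a m n N) +
        (z + a) / denom a n * weightedMoment a ha n ⟨t, htn⟩
          (fun x => if x = z then 1 else 0) m S (dualWeight a m n N) := by
      rw [← weightedMoment_const_mul, ← weightedMoment_const_mul, ← weightedMoment_add]
      congr 1
      funext x
      by_cases hx : x = z + 1
      · simp [hx]
      · by_cases hx' : x = z
        · simp [hx']
        · simp [hx, hx']
    refine h1.trans (h2.le.trans ?_)
    -- Nonnegativity is needed to insert the induction hypothesis; it rests on `z ≤ n` and `a * n ≥
    -- a * t ≥ 1`.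
    have hc : 0 ≤ 1 - (z + 1 + a) / denom a n + m / denom a n := by
      have hz' : (z : ℝ) ≤ n := by exact_mod_cast Nat.le_of_succ_le_succ hz
      have htn' : (t : ℝ) ≤ n := by exact_mod_cast (Nat.le_succ t).trans htn
      have h3 : a * t ≤ a * n := by gcongr
      have : (z + 1 + a) / denom a n ≤ 1 := by
        rw [div_le_one hτ, denom]
        linarith
      have : 0 ≤ m / denom a n := by positivity
      linarith
    have h3 : 1 + (a + m) / denom a n ≤ Real.exp ((a + m) * (1 / denom a n)) := by
      have := Real.add_one_le_exp ((a + m) * (1 / denom a n))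
      rw [mul_one_div] at this ⊢
      linarith
    have h4 : 1 + (m - 1) / denom a n ≤ Real.exp ((m - 1) * (1 / denom a n)) := by
      have := Real.add_one_le_exp (((m : ℝ) - 1) * (1 / denom a n))
      rw [mul_one_div] at this ⊢
      linarith
    have h5 := parentFreq_rec ha z
    have h6 := (parentFreq_pos ha (z + 1)).le
    set E₁ := Real.exp ((a + m) * logTime a t n) with hE₁
    set E₂ := Real.exp ((m - 1) * logTime a t n) with hE₂
    calc _ ≤ (1 - (z + 1 + a) / denom a n + m / denom a n) * (rising S m (a * S) *
          (parentFreq a (z + 1) * E₁ + K / denom a t * E₂)) +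
          (z + a) / denom a n * (rising S m (a * S) *
          (parentFreq a z * E₁ + K / denom a t * E₂)) := by
          gcongr
          · exact ih (by omega) (z + 1)
          · exact ih (by omega) z
      _ = rising S m (a * S) * (parentFreq a (z + 1) * E₁ * (1 + (a + m) / denom a n) +
          K / denom a t * E₂ * (1 + (m - 1) / denom a n)) := by
          linear_combination (-rising S m (a * S) * E₁ / denom a n) * h5
      _ ≤ rising S m (a * S) * (parentFreq a (z + 1) * E₁ * Real.exp ((a + m) * (1 / denom a n)) +
          K / denom a t * E₂ * Real.exp ((m - 1) * (1 / denom a n))) := by gcongr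
      _ = _ := by
        simp only [hE₁, hE₂, logTime_succ htn, mul_add _ (logTime a t n), Real.exp_add]
        ring

/-- Tail bound for the number of grandchildren. -/
theorem expect_grandDeg_tail_le (ha : 0 < a) (m w t N : ℕ) (h : t < N) :
    (w : ℝ) ^ m * (expect a ha N fun G =>
      if target G ⟨t, h⟩ ≠ ⟨t, h⟩ ∧ w ≤ grandDeg G ⟨t, h⟩ then (1 : ℝ) else 0) ≤
    (∏ i ∈ range m, (a + i)) * (dualWeight a m (t + 1) N ^ m * Real.exp (m * logTime a t N)) := by
  have h1 := weightedMoment_one_le ha m t N N h le_rfl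
  rw [rising_self_mul] at h1
  refine le_trans ?_ (h1.trans_eq (by ring))
  rw [← expect_const_mul]
  refine expect_mono fun G => ?_
  have hS : 1 ≤ dualWeight a m (t + 1) N := one_le_dualWeight ha _ _ _
  have hs : 1 ≤ dualWeight a m N N := one_le_dualWeight ha _ _ _
  by_cases ht : target G ⟨t, h⟩ = ⟨t, h⟩
  · simp [ht]
  · rw [if_neg ht, one_mul]
    have hnn : 0 ≤ rising (dualWeight a m (t + 1) N) m (grandDeg G ⟨t, h⟩ +
        dualWeight a m N N * indeg G ⟨t, h⟩ + a * dualWeight a m (t + 1) N) :=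
      rising_nonneg (by linarith) (by positivity)
    split_ifs with hw
    · rw [mul_one]
      refine le_trans (pow_le_pow_left₀ (by positivity) ?_ m) (pow_le_rising (by linarith) (by positivity))
      have : (w : ℝ) ≤ grandDeg G ⟨t, h⟩ := by exact_mod_cast hw.2
      have : 0 ≤ dualWeight a m N N * indeg G ⟨t, h⟩ := by positivity
      have : 0 ≤ a * dualWeight a m (t + 1) N := by positivity
      linarith
    · simpa using hnn

/-- Joint bound for the indegree of the parent and the number of grandchildren. -/
theorem expect_joint_tail_le (ha : 0 < a) {K : ℝ}
    (hK : ∀ n j : ℕ, (j + a) * |degError a ha n j| ≤ K) (m w z t N : ℕ) (hat : 1 ≤ a * t)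
    (h : t < N) :
    (w : ℝ) ^ m * (expect a ha N fun G => if target G ⟨t, h⟩ ≠ ⟨t, h⟩ ∧ parentDeg G ⟨t, h⟩ = z ∧
      w ≤ grandDeg G ⟨t, h⟩ then (1 : ℝ) else 0) ≤
    (∏ i ∈ range m, (a + i)) * (dualWeight a m (t + 1) N ^ m *
      (parentFreq a z * Real.exp ((a + m) * logTime a t N)
          + K / denom a t * Real.exp ((m - 1) * logTime a t N))) := by
  have h1 := weightedMoment_indicator_le ha hK m t N N hat h le_rfl z
  rw [rising_self_mul] at h1
  refine le_trans ?_ (h1.trans_eq (by ring))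
  rw [← expect_const_mul]
  refine expect_mono fun G => ?_
  have hS : 1 ≤ dualWeight a m (t + 1) N := one_le_dualWeight ha _ _ _
  have hs : 1 ≤ dualWeight a m N N := one_le_dualWeight ha _ _ _
  by_cases ht : target G ⟨t, h⟩ = ⟨t, h⟩
  · simp [ht]
  · rw [if_neg ht]
    beta_reduce
    have hnn : 0 ≤ rising (dualWeight a m (t + 1) N) m (grandDeg G ⟨t, h⟩ +
        dualWeight a m N N * indeg G ⟨t, h⟩ + a * dualWeight a m (t + 1) N) :=
      rising_nonneg (by linarith) (by positivity)
    by_cases hw : parentDeg G ⟨t, h⟩ = z ∧ w ≤ grandDeg G ⟨t, h⟩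
    · rw [if_pos ⟨ht, hw⟩, if_pos hw.1, mul_one, one_mul]
      refine le_trans (pow_le_pow_left₀ (by positivity) ?_ m) (pow_le_rising (by linarith) (by positivity))
      have : (w : ℝ) ≤ grandDeg G ⟨t, h⟩ := by exact_mod_cast hw.2
      have : 0 ≤ dualWeight a m N N * indeg G ⟨t, h⟩ := by positivity
      have : 0 ≤ a * dualWeight a m (t + 1) N := by positivity
      linarith
    · rw [if_neg (fun h' => hw h'.2), mul_zero]
      split_ifs
      · simpa using hnn
      · simp

end Moments

/-! ### Gamma ratios and the asymptotics of the limiting tail -/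

section GammaRatio

theorem log_Gamma_add_one {x : ℝ} (hx : 0 < x) :
    Real.log (Real.Gamma (x + 1)) = Real.log x + Real.log (Real.Gamma x) := by
  rw [Real.Gamma_add_one hx.ne', Real.log_mul hx.ne' (Real.Gamma_pos_of_pos hx).ne']

/-- Log-convexity of Gamma: its slope on `[x, x+s]` is at most that on `[x+s, x+s+1]`, which is `log
(x+s)`. The companion lower bound uses `[x-1, x]`. -/
theorem Gamma_add_le_rpow_mul {x s : ℝ} (hx : 0 < x) (hs : 0 < s) :
    Real.Gamma (x + s) ≤ (x + s) ^ s * Real.Gamma x := by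
  have h := Real.convexOn_log_Gamma.slope_mono_adjacent (x := x) (y := x + s) (z := x + s + 1)
    hx (show 0 < x + s + 1 by positivity) (by linarith) (by linarith)
  simp only [Function.comp, log_Gamma_add_one (add_pos hx hs)] at h
  rw [add_sub_cancel_right, add_sub_cancel_left, add_sub_cancel_left, div_one,
    div_le_iff₀ hs] at h
  have hG := Real.Gamma_pos_of_pos hx
  have hG' := Real.Gamma_pos_of_pos (add_pos hx hs)
  rw [← Real.log_le_log_iff hG' (by positivity), Real.log_mul (by positivity) hG.ne',
    Real.log_rpow (by positivity)]
  linarith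

theorem rpow_mul_Gamma_le {x s : ℝ} (hx : 1 < x) (hs : 0 < s) :
    (x - 1) ^ s * Real.Gamma x ≤ Real.Gamma (x + s) := by
  have hx0 : 0 < x - 1 := by linarith
  have h := Real.convexOn_log_Gamma.slope_mono_adjacent (x := x - 1) (y := x) (z := x + s)
    hx0 (show 0 < x + s by positivity) (by linarith) (by linarith)
  have h1 := log_Gamma_add_one hx0
  rw [sub_add_cancel] at h1
  simp only [Function.comp, h1] at h
  rw [sub_sub_cancel, add_sub_cancel_left, div_one, le_div_iff₀ hs] at h
  have hG := Real.Gamma_pos_of_pos (show 0 < x by linarith)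
  have hG' := Real.Gamma_pos_of_pos (show 0 < x + s by linarith)
  rw [← Real.log_le_log_iff (by positivity) hG', Real.log_mul (by positivity) hG.ne',
    Real.log_rpow hx0, h1]
  linarith

variable {a : ℝ}

theorem parentFreq_eq_Gamma (ha : 0 < a) (z : ℕ) :
    parentFreq a z = (a + 1) * Real.Gamma (2 * a + 1) / Real.Gamma a *
      (Real.Gamma (z + a) / Real.Gamma (z + 2 * a + 1)) := by
  induction z with
  | zero =>
    have h1 := (Real.Gamma_pos_of_pos ha).ne'
    have h2 := (Real.Gamma_pos_of_pos (show 0 < 2 * a + 1 by positivity)).ne'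
    simp only [parentFreq, limitFreq, Nat.cast_zero, zero_add]
    field_simp
  | succ z ih =>
    have h := parentFreq_rec ha z
    have h0 : (0 : ℝ) < z + 1 + 2 * a := by positivity
    have h1 : (0 : ℝ) < z + a := by positivity
    have h2 := (Real.Gamma_pos_of_pos h1).ne'
    have h3 := (Real.Gamma_pos_of_pos (show 0 < z + 2 * a + 1 by positivity)).ne'
    have h4 : Real.Gamma ((z + 1 : ℕ) + a) = (z + a) * Real.Gamma (z + a) := by
      rw [← Real.Gamma_add_one h1.ne']
      push_cast
      ring_nf
    have h5 : Real.Gamma ((z + 1 : ℕ) + 2 * a + 1) =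
        (z + 1 + 2 * a) * Real.Gamma (z + 2 * a + 1) := by
      rw [← show z + 2 * a + 1 = z + 1 + 2 * a by ring, ← Real.Gamma_add_one (by positivity)]
      push_cast
      ring_nf
    rw [ih] at h
    rw [h4, h5]
    refine mul_left_cancel₀ h0.ne' (h.trans ?_)
    field_simp

theorem rpow_mul_parentFreq_bounds (ha : 0 < a) : ∃ A : ℝ, 0 < A ∧ ∀ z : ℕ, 1 ≤ z →
    |(z : ℝ) ^ (a + 1) * (Real.Gamma (z + a) / Real.Gamma (z + 2 * a + 1)) - 1| ≤ A / z := by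
  -- The first summand comes from Bernoulli's inequality in the lower bound. The second serves the
  -- upper bound when `a < 1`, where the denominator is only known to be at least `a ^ 2`.
  refine ⟨(a + 1) * (2 * a + 1) + 1 / a ^ 2, by positivity, fun z hz => ?_⟩
  have hz1 : (1 : ℝ) ≤ z := by exact_mod_cast hz
  have hz0 : (0 : ℝ) < z := by linarith
  have hs : 0 < a + 1 := by positivity
  have hx : 0 < z + a := by positivity
  have hxs : z + a + (a + 1) = z + 2 * a + 1 := by ring
  have hG := Real.Gamma_pos_of_pos hx
  have hG' := Real.Gamma_pos_of_pos (show 0 < z + 2 * a + 1 by positivity)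
  have hlow : (z : ℝ) ^ (a + 1) / (z + 2 * a + 1) ^ (a + 1) ≤
      (z : ℝ) ^ (a + 1) * (Real.Gamma (z + a) / Real.Gamma (z + 2 * a + 1)) := by
    have h := Gamma_add_le_rpow_mul hx hs
    rw [hxs] at h
    rw [← mul_one_div]
    refine mul_le_mul_of_nonneg_left ?_ (by positivity)
    rw [div_le_div_iff₀ (by positivity) hG', one_mul]
    exact h.trans_eq (mul_comm _ _)
  have hx1 : 0 < z + a - 1 := by linarith
  have hupp : (z : ℝ) ^ (a + 1) * (Real.Gamma (z + a) / Real.Gamma (z + 2 * a + 1)) ≤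
      1 / ((z + a - 1) / z) ^ (a + 1) := by
    have h := rpow_mul_Gamma_le (show 1 < z + a by linarith) hs
    rw [hxs] at h
    rw [Real.div_rpow hx1.le hz0.le, one_div_div, ← mul_one_div (_ ^ _) (_ ^ _)]
    refine mul_le_mul_of_nonneg_left ?_ (by positivity)
    rw [div_le_div_iff₀ hG' (by positivity), one_mul]
    exact (mul_comm _ _).trans_le h
  have h1 : 1 - (a + 1) * (2 * a + 1) / z ≤ (z : ℝ) ^ (a + 1) / (z + 2 * a + 1) ^ (a + 1) := by
    rw [← Real.div_rpow hz0.le (by positivity)]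
    have hb := one_add_mul_self_le_rpow_one_add (s := -((2 * a + 1) / (z + 2 * a + 1)))
      (neg_le_neg (by rw [div_le_one (by positivity)]; linarith)) (show 1 ≤ a + 1 by linarith)
    have he : 1 + -((2 * a + 1) / (z + 2 * a + 1)) = z / (z + 2 * a + 1) := by
      field_simp
      ring
    rw [he] at hb
    refine le_trans ?_ hb
    have : (2 * a + 1) / (z + 2 * a + 1) ≤ (2 * a + 1) / z := by
      gcongr
      linarith
    have := mul_le_mul_of_nonneg_left this hs.le
    rw [mul_div_assoc]
    linarith
  have h2 : 1 / ((z + a - 1) / z) ^ (a + 1) ≤ 1 + 1 / a ^ 2 / z := by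
    have hb := one_add_mul_self_le_rpow_one_add (s := (a - 1) / z)
      (by rw [le_div_iff₀ hz0]; linarith) (show 1 ≤ a + 1 by linarith)
    have he : 1 + (a - 1) / z = (z + a - 1) / z := by
      field_simp
      ring
    rw [he] at hb
    set q := ((z + a - 1) / z) ^ (a + 1)
    have hq : 0 < q := Real.rpow_pos_of_pos (by positivity) _
    have hb' : 1 - (1 - a ^ 2) / z ≤ q := by
      refine le_trans (le_of_eq ?_) hb
      field_simp
      ring
    rcases le_or_gt 1 a with h | h
    · have hq1 : 1 ≤ q := by
        refine le_trans ?_ hb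
        have : 0 ≤ (a + 1) * ((a - 1) / z) :=
          mul_nonneg hs.le (div_nonneg (by linarith) hz0.le)
        linarith
      have h3 : 1 / q ≤ 1 := by rw [div_le_one hq]; exact hq1
      have h4 : 0 ≤ 1 / a ^ 2 / z := by positivity
      linarith
    · have ha2 : a ^ 2 ≤ 1 := by nlinarith
      have h3 : (1 - a ^ 2) / z ≤ 1 - a ^ 2 := div_le_self (by linarith) hz1
      have h4 : a ^ 2 ≤ q := by linarith
      have h5 : (1 - a ^ 2) / z ≤ 1 / z := by
        gcongr
        nlinarith
      have h6 : 1 / z ≤ 1 / a ^ 2 / z * q := by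
        rw [div_mul_eq_mul_div, div_mul_eq_mul_div, one_mul]
        gcongr
        rw [le_div_iff₀ (by positivity)]
        linarith
      rw [div_le_iff₀ hq]
      linarith
  have h3 : 0 ≤ (a + 1) * (2 * a + 1) / z := by positivity
  have h4 : 0 ≤ 1 / a ^ 2 / z := by positivity
  rw [abs_le, add_div]
  constructor <;> linarith

theorem parentFreq_le (ha : 0 < a) : ∃ A : ℝ, 0 < A ∧ ∀ z : ℕ, 1 ≤ z →
    (z : ℝ) ^ (a + 1) * parentFreq a z ≤ A := by
  obtain ⟨A, hA, h⟩ := rpow_mul_parentFreq_bounds ha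
  have h1 := Real.Gamma_pos_of_pos ha
  have h2 := Real.Gamma_pos_of_pos (show 0 < 2 * a + 1 by positivity)
  refine ⟨(a + 1) * Real.Gamma (2 * a + 1) / Real.Gamma a * (1 + A), by positivity,
    fun z hz => ?_⟩
  have hz' : (1 : ℝ) ≤ z := by exact_mod_cast hz
  have h3 := (abs_le.1 (h z hz)).2
  have h4 : A / z ≤ A := div_le_self hA.le hz'
  rw [parentFreq_eq_Gamma ha, mul_left_comm]
  gcongr
  linarith

/-- The coefficient of the power law of second degrees. -/
noncomputable def tailConst (a : ℝ) : ℝ :=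
  (a + 1) * Real.Gamma (2 * a + 1) / Real.Gamma (a + 1)

theorem tailConst_pos (ha : 0 < a) : 0 < tailConst a := by
  have h1 := Real.Gamma_pos_of_pos (show 0 < a + 1 by positivity)
  have h2 := Real.Gamma_pos_of_pos (show 0 < 2 * a + 1 by positivity)
  unfold tailConst
  positivity

theorem limitTail_bound (ha : 0 < a) : ∃ A : ℝ, 0 < A ∧ ∀ k : ℕ, 1 ≤ k →
    |limitTail a k - tailConst a / (k : ℝ) ^ a| ≤ A / (k : ℝ) ^ (a + 1) := by
  obtain ⟨A, hA, h⟩ := rpow_mul_parentFreq_bounds ha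
  have hc := tailConst_pos ha
  refine ⟨tailConst a * (A + (1 + A)), by positivity, fun k hk => ?_⟩
  have hk' : (1 : ℝ) ≤ k := by exact_mod_cast hk
  have hk0 : (0 : ℝ) < k := by linarith
  set R := (k : ℝ) ^ (a + 1) * (Real.Gamma (k + a) / Real.Gamma (k + 2 * a + 1)) with hR
  have hRb := h k hk
  have hp : (k : ℝ) ^ (a + 1) = k ^ a * k := Real.rpow_add_one hk0.ne' a
  have hpa : (0 : ℝ) < k ^ a := Real.rpow_pos_of_pos hk0 a
  have h1 : limitTail a k = (k + a / (a + 1)) * tailConst a * (R / k ^ (a + 1)) := by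
    rw [hR, mul_div_cancel_left₀ _ (by positivity)]
    have h2 : limitTail a k = (k / a + 1 / (a + 1)) * parentFreq a k := rfl
    have h3 := (Real.Gamma_pos_of_pos ha).ne'
    rw [h2, parentFreq_eq_Gamma ha, tailConst, Real.Gamma_add_one ha.ne']
    have : a + 1 ≠ 0 := by positivity
    field_simp
  have h2 : limitTail a k - tailConst a / (k : ℝ) ^ a =
      tailConst a * (k * (R - 1) + a / (a + 1) * R) / k ^ (a + 1) := by
    rw [h1, hp]
    field_simp
    ring
  rw [h2, abs_div, abs_of_pos (show (0 : ℝ) < k ^ (a + 1) by positivity), abs_mul,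
    abs_of_pos hc]
  gcongr
  have h3 : |(k : ℝ) * (R - 1)| ≤ A := by
    rw [abs_mul, abs_of_pos hk0, mul_comm]
    rwa [le_div_iff₀ hk0] at hRb
  have h4 : |R| ≤ 1 + A := by
    have h5 : A / k ≤ A := div_le_self hA.le hk'
    have h6 := abs_le.1 hRb
    rw [abs_le]
    constructor <;> linarith
  have h5 : |a / (a + 1) * R| ≤ 1 + A := by
    rw [abs_mul, abs_of_pos (by positivity : 0 < a / (a + 1))]
    refine (mul_le_of_le_one_left (abs_nonneg R) ?_).trans h4
    rw [div_le_one (by positivity)]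
    linarith
  exact (abs_add_le _ _).trans (add_le_add h3 h5)

end GammaRatio

/-! ### Second degree versus parent degree and grandchildren -/

section SecondDegree

variable {n : ℕ}

/-- Every edge into the parent other than that of `t` itself is counted; the excluded edge is the `+
1`. -/
theorem parentDeg_le_secondDegree (G : Graph n) {t : Fin n} (ht : target G t ≠ t) :
    parentDeg G t ≤ secondDegree G t + 1 := by
  unfold parentDeg indeg secondDegree
  have hsub : ({e : Fin n | target G e = target G t} : Finset (Fin n)).erase t ⊆
      ({e : Fin n | t ∉ ends G e ∧ ∃ i, i ∈ ends G e ∧ ∃ e', ends G e' = s(i, t)} :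
        Finset (Fin n)) := by
    intro e he
    simp only [Finset.mem_erase, Finset.mem_filter, Finset.mem_univ, true_and] at he ⊢
    refine ⟨?_, target G t, ?_, t, ?_⟩
    · rw [ends, Sym2.mem_iff, he.2]
      rintro (h | h)
      · exact he.1 h.symm
      · exact ht h.symm
    · rw [ends, Sym2.mem_iff]
      exact Or.inr he.2.symm
    · rw [ends, Sym2.eq_swap]
  have := Finset.card_le_card hsub
  rw [Finset.card_erase_of_mem (by simp)] at this
  omega

/-- A counted edge touches the parent (its own edge, or a sibling's) or enters a child of `t`. The
parent's own edge makes up for the excluded edge of `t`. -/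
theorem secondDegree_le (G : Graph n) {t : Fin n} (ht : target G t ≠ t) :
    secondDegree G t ≤ parentDeg G t + grandDeg G t := by
  unfold secondDegree
  have hsub : ({e : Fin n | t ∉ ends G e ∧ ∃ i, i ∈ ends G e ∧ ∃ e', ends G e' = s(i, t)} :
        Finset (Fin n)) ⊆
      insert (target G t) (({e : Fin n | target G e = target G t} : Finset (Fin n)).erase t) ∪
        ({e : Fin n | target G (target G e) = t} : Finset (Fin n)) := by
    intro e he
    simp only [Finset.mem_filter, Finset.mem_univ, true_and] at he
    obtain ⟨h1, i, hi, e', he'⟩ := he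
    rw [ends, Sym2.mem_iff, not_or] at h1
    rw [ends, Sym2.mem_iff] at hi
    rw [ends, Sym2.eq_iff] at he'
    simp only [Finset.mem_union, Finset.mem_insert, Finset.mem_erase, Finset.mem_filter,
      Finset.mem_univ, true_and]
    rcases he' with ⟨h2, h3⟩ | ⟨h2, h3⟩
    · subst h2
      rcases hi with hi | hi
      · exact absurd (hi ▸ h3).symm h1.2
      · right
        rw [← hi, h3]
    · subst h2
      left
      rcases hi with hi | hi
      · left
        rw [h3, hi]
      · right
        exact ⟨fun h => h1.1 h.symm, by rw [← hi, h3]⟩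
  have h1 := (Finset.card_le_card hsub).trans (Finset.card_union_le _ _)
  have h2 := Finset.card_insert_le (target G t)
    (({e : Fin n | target G e = target G t} : Finset (Fin n)).erase t)
  rw [Finset.card_erase_of_mem (by simp)] at h2
  have h3 := one_le_parentDeg G t
  unfold parentDeg indeg grandDeg at *
  omega

/-- The number of loops. -/
def numLoops (G : Graph n) : ℕ := #{t : Fin n | target G t = t}

/-- The number of vertices that send their edge to a vertex of indegree at least `k`. -/
def numLargeParent (k : ℕ) (G : Graph n) : ℕ := #{t : Fin n | k ≤ parentDeg G t}

/-- The event that `t` has second degree at least `k` only because of its grandchildren. -/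
def IsException (k : ℕ) (G : Graph n) (t : Fin n) : Prop :=
  target G t ≠ t ∧ parentDeg G t < k ∧ k ≤ parentDeg G t + grandDeg G t

instance (k : ℕ) (G : Graph n) : DecidablePred (IsException k G) := fun t => by
  unfold IsException
  infer_instance

theorem numLargeParent_le (k : ℕ) (G : Graph n) :
    numLargeParent (k + 1) G ≤ numKVertices k G + numLoops G := by
  unfold numLargeParent numKVertices numLoops
  refine le_trans (Finset.card_le_card fun t ht => ?_) (Finset.card_union_le _ _)
  simp only [Finset.mem_union, Finset.mem_filter, Finset.mem_univ, true_and] at ht ⊢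
  by_cases h : target G t = t
  · exact Or.inr h
  · have := parentDeg_le_secondDegree G h
    left
    omega

theorem numKVertices_le (k : ℕ) (G : Graph n) :
    numKVertices k G ≤ numLargeParent k G + numLoops G + #{t : Fin n | IsException k G t} := by
  unfold numLargeParent numKVertices numLoops
  refine le_trans (Finset.card_le_card fun t ht => ?_)
    ((Finset.card_union_le _ _).trans (Nat.add_le_add_right (Finset.card_union_le _ _) _))
  simp only [Finset.mem_union, Finset.mem_filter, Finset.mem_univ, true_and] at ht ⊢
  by_cases h : target G t = t
  · exact Or.inl (Or.inr h)
  · have := secondDegree_le G h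
    by_cases h' : k ≤ parentDeg G t
    · exact Or.inl (Or.inl h')
    · exact Or.inr ⟨h, by omega, by omega⟩

theorem numLargeParent_eq (k : ℕ) (G : Graph n) : (numLargeParent k G : ℝ) =
    n - ∑ j ∈ range k, (j : ℝ) * ∑ v : Fin n, if indeg G v = j then (1 : ℝ) else 0 := by
  have h1 : (numLargeParent k G : ℝ) = ∑ v, (indeg G v : ℝ) * if k ≤ indeg G v then 1 else 0 := by
    rw [sum_indeg_mul, numLargeParent, Finset.card_filter]
    push_cast
    rfl
  have h2 : ∑ j ∈ range k, (j : ℝ) * (∑ v : Fin n, if indeg G v = j then (1 : ℝ) else 0) =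
      ∑ v, (indeg G v : ℝ) * if indeg G v < k then 1 else 0 := by
    simp only [Finset.mul_sum]
    rw [Finset.sum_comm]
    refine Finset.sum_congr rfl fun v _ => ?_
    by_cases h : indeg G v < k
    · rw [if_pos h, Finset.sum_eq_single_of_mem (indeg G v) (Finset.mem_range.2 h)]
      · simp
      · intro j _ hj
        rw [if_neg hj.symm, mul_zero]
    · rw [if_neg h, mul_zero]
      refine Finset.sum_eq_zero fun j hj => ?_
      rw [Finset.mem_range] at hj
      rw [if_neg (by omega), mul_zero]
  rw [h1, h2, ← sum_indeg G, ← Finset.sum_sub_distrib]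
  refine Finset.sum_congr rfl fun v _ => ?_
  by_cases h : indeg G v < k
  · rw [if_pos h, if_neg (by omega)]
    ring
  · rw [if_neg h, if_pos (by omega)]
    ring

end SecondDegree

/-! ### Expected loops and the main term -/

section Expectations

variable {a : ℝ} {ha : 0 < a}

theorem expect_numLoops_le (n : ℕ) (hn : 1 ≤ n) :
    (expect a ha n fun G => (numLoops G : ℝ)) ≤ 1 + Real.log n := by
  have hstep : ∀ n : ℕ, (expect a ha (n + 1) fun G => (numLoops G : ℝ)) =
      (expect a ha n fun G => (numLoops G : ℝ)) + a / denom a n := by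
    intro n
    rw [expect_succ, ← expect_const (a := a) (ha := ha) (n := n) (a / denom a n), ← expect_add]
    congr 1
    funext G
    have h : ∀ s, (numLoops (addVertex G s) : ℝ) =
        numLoops G + if s = Fin.last n then 1 else 0 := by
      intro s
      unfold numLoops
      simp only [Finset.card_filter, Fin.sum_univ_castSucc, target_addVertex_castSucc,
        target_addVertex_last, Fin.castSucc_inj]
      push_cast
      rfl
    simp only [h, mul_add, Finset.sum_add_distrib, ← Finset.sum_mul, sum_attachProb ha G, one_mul]
    simp [attachProb_last]
  induction n, hn using Nat.le_induction with
  | base =>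
    have h0 : (expect a ha 0 fun G => (numLoops G : ℝ)) = 0 := by simp [expect, numLoops]
    rw [show (1 : ℕ) = 0 + 1 from rfl, hstep, h0, denom]
    simp [ha.ne']
  | succ n hn ih =>
    have hn0 : (0 : ℝ) < n := by exact_mod_cast hn
    rw [hstep]
    have h1 : a / denom a n ≤ 1 / (n + 1) := by
      rw [div_le_div_iff₀ (denom_pos' ha n) (by positivity), denom]
      nlinarith
    have h2 : 1 / ((n : ℝ) + 1) ≤ Real.log (n + 1) - Real.log n := by
      have h := Real.one_sub_inv_le_log_of_pos (show 0 < ((n : ℝ) + 1) / n by positivity)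
      rw [Real.log_div (by positivity) hn0.ne'] at h
      refine le_trans (le_of_eq ?_) h
      field_simp
      ring
    push_cast
    linarith

theorem expect_numLargeParent_bound (ha : 0 < a) : ∃ K : ℝ, 0 < K ∧ ∀ n k : ℕ, 1 ≤ k →
    |(expect a ha n fun G => (numLargeParent k G : ℝ)) - n * limitTail a k| ≤ K * k := by
  obtain ⟨K, hK, h⟩ := degError_bound ha
  refine ⟨K + 1, by positivity, fun n k hk => ?_⟩
  have hk' : (1 : ℝ) ≤ k := by exact_mod_cast hk
  have h1 : (expect a ha n fun G => (numLargeParent k G : ℝ)) =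
      n - ∑ j ∈ range k, (j : ℝ) * degCount a ha n j := by
    simp only [numLargeParent_eq]
    rw [expect_sub, expect_const, expect_sum]
    simp only [expect_const_mul]
    rfl
  have h2 : ∑ j ∈ range k, (j : ℝ) * degCount a ha n j =
      (n + a / (a + 1)) * (1 - limitTail a k) + ∑ j ∈ range k, (j : ℝ) * degError a ha n j := by
    rw [← sum_mul_limitFreq ha, Finset.mul_sum, ← Finset.sum_add_distrib]
    refine Finset.sum_congr rfl fun j _ => ?_
    unfold degError
    ring
  have h3 : |∑ j ∈ range k, (j : ℝ) * degError a ha n j| ≤ K * k := by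
    refine (Finset.abs_sum_le_sum_abs _ _).trans ?_
    calc ∑ j ∈ range k, |(j : ℝ) * degError a ha n j| ≤ ∑ _j ∈ range k, K := by
          refine Finset.sum_le_sum fun j _ => ?_
          rw [abs_mul, abs_of_nonneg (Nat.cast_nonneg j)]
          refine le_trans ?_ (h n j)
          gcongr
          linarith
      _ = K * k := by simp [mul_comm]
  have h4 : 0 ≤ 1 - limitTail a k := by
    rw [← sum_mul_limitFreq ha]
    exact Finset.sum_nonneg fun j _ => by have := limitFreq_pos ha j; positivity
  have h5 : 0 ≤ limitTail a k := by
    have := limitFreq_pos ha k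
    unfold limitTail
    positivity
  have h6 : a / (a + 1) ≤ 1 := by rw [div_le_one (by positivity)]; linarith
  have h7 : 0 ≤ a / (a + 1) := by positivity
  have h8 : a / (a + 1) * (1 - limitTail a k) ≤ 1 := mul_le_one₀ h6 h4 (by linarith)
  have h9 : 0 ≤ a / (a + 1) * (1 - limitTail a k) := mul_nonneg h7 h4
  have h10 := abs_le.1 h3
  have h11 : (expect a ha n fun G => (numLargeParent k G : ℝ)) - n * limitTail a k =
      -(a / (a + 1) * (1 - limitTail a k)) - ∑ j ∈ range k, (j : ℝ) * degError a ha n j := by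
    rw [h1, h2]
    ring
  rw [h11, abs_le]
  constructor <;> linarith

end Expectations

/-! ### Probability that a vertex is exceptional -/

section Exceptions

variable {a : ℝ} {ha : 0 < a}

theorem mul_exp_logTime_le (ha : 0 < a) {t n : ℕ} (ht : 1 ≤ t) (htn : t < n) :
    Real.exp ((a + 1) * logTime a t n) ≤ n / t := by
  have ht0 : (0 : ℝ) < t := by exact_mod_cast ht
  have key : Real.exp ((a + 1) * logTime a t n) ≤ (n - 1) / t := by
    induction n, htn using Nat.le_induction with
    | base => simp [logTime, ht0.ne']
    | succ n htn ih =>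
      have hn : (1 : ℝ) < n := by exact_mod_cast (by omega : 1 < n)
      have h1 : (a + 1) * (1 / denom a n) ≤ 1 / n := by
        rw [mul_one_div, div_le_div_iff₀ (denom_pos' ha n) (by linarith), denom]
        linarith
      have h2 : Real.exp (1 / n) ≤ n / (n - 1) := by
        have h := Real.add_one_le_exp (-(1 / (n : ℝ)))
        rw [Real.exp_neg] at h
        rw [le_div_iff₀ (by linarith), mul_comm, ← le_div_iff₀ (Real.exp_pos _), div_eq_mul_inv]
        calc (n : ℝ) - 1 = n * (-(1 / (n : ℝ)) + 1) := by field_simp; ring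
          _ ≤ _ := by gcongr
      rw [logTime_succ htn, mul_add, Real.exp_add]
      push_cast
      calc _ ≤ (n - 1) / t * (n / (n - 1) : ℝ) := by
            gcongr
            exact (Real.exp_le_exp.2 h1).trans h2
        _ = _ := by
          have : (n : ℝ) - 1 ≠ 0 := by linarith
          field_simp
          ring
  refine key.trans ?_
  gcongr
  linarith

theorem logTime_le (ha : 0 < a) {t n : ℕ} (ht : 1 ≤ t) (htn : t < n) :
    logTime a t n ≤ Real.log (n / t) := by
  have ht0 : (0 : ℝ) < t := by exact_mod_cast ht
  have hn0 : (0 : ℝ) < n := by exact_mod_cast (by omega : 0 < n)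
  have h := mul_exp_logTime_le ha ht htn
  rw [← Real.le_log_iff_exp_le (by positivity)] at h
  have := logTime_nonneg ha t n
  nlinarith

/-- The hypotheses say `J w ≤ M F min(1, V²/w²)`, hence `(V + w)² J w ≤ 4 M F V²`; the series
`1/((V+w-1)(V+w))` telescopes to at most `1/V`. -/
theorem sum_le_of_sq_bound {F V M : ℝ} {h : ℕ} {J : ℕ → ℝ} (hF : 0 ≤ F) (hV : 1 ≤ V) (hM : 0 ≤ M)
    (hJ₀ : ∀ w ∈ Ico 1 h, 0 ≤ J w) (hJ₁ : ∀ w ∈ Ico 1 h, J w ≤ M * F)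
    (hJ₂ : ∀ w ∈ Ico 1 h, (w : ℝ) ^ 2 * J w ≤ M * V ^ 2 * F) :
    ∑ w ∈ Ico 1 h, J w ≤ 4 * M * (F * V) := by
  have hV0 : 0 < V := by linarith
  have hterm : ∀ w ∈ Ico 1 h, J w ≤
      4 * M * F * V ^ 2 * (1 / (V + (w : ℝ) - 1) - 1 / (V + (w + 1 : ℕ) - 1)) := by
    intro w hw
    have hw1 : (1 : ℝ) ≤ w := by exact_mod_cast (Finset.mem_Ico.1 hw).1
    have h0 := hJ₀ w hw
    have h1 : (V + w) ^ 2 * J w ≤ 4 * M * F * V ^ 2 := by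
      rcases le_total (w : ℝ) V with h | h
      · calc (V + w) ^ 2 * J w ≤ (V + V) ^ 2 * (M * F) := by
              gcongr
              exact hJ₁ w hw
          _ = _ := by ring
      · calc (V + w) ^ 2 * J w ≤ (w + w) ^ 2 * J w := by gcongr
          _ = 4 * ((w : ℝ) ^ 2 * J w) := by ring
          _ ≤ 4 * (M * V ^ 2 * F) := by
              exact mul_le_mul_of_nonneg_left (hJ₂ w hw) (by norm_num)
          _ = _ := by ring
    have h2 : (0 : ℝ) < V + w - 1 := by linarith
    have h3 : (0 : ℝ) < V + w := by linarith
    have h4 : 1 / (V + (w : ℝ) - 1) - 1 / (V + (w + 1 : ℕ) - 1) = 1 / ((V + w - 1) * (V + w)) := by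
      push_cast
      rw [show V + (w + 1) - 1 = V + (w : ℝ) by ring]
      field_simp
      ring
    rw [h4, mul_one_div, le_div_iff₀ (by positivity)]
    refine le_trans ?_ h1
    rw [mul_comm]
    refine mul_le_mul_of_nonneg_right ?_ h0
    rw [sq]
    gcongr
    linarith
  rcases Nat.eq_zero_or_pos h with rfl | hh
  · simp
    positivity
  · refine (Finset.sum_le_sum hterm).trans ?_
    rw [← Finset.mul_sum]
    have htel : ∑ w ∈ Ico 1 h, (1 / (V + (w : ℝ) - 1) - 1 / (V + (w + 1 : ℕ) - 1)) ≤ 1 / V := by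
      have h1 := Finset.sum_Ico_sub (fun w : ℕ => -(1 / (V + (w : ℝ) - 1))) hh
      have h2 : ∑ w ∈ Ico 1 h, (1 / (V + (w : ℝ) - 1) - 1 / (V + (w + 1 : ℕ) - 1)) =
          1 / V - 1 / (V + h - 1) := by
        refine (Finset.sum_congr rfl fun w _ => ?_).trans (h1.trans ?_)
        · ring
        · push_cast
          rw [add_sub_cancel_right]
          ring
      have hh' : (1 : ℝ) ≤ h := by exact_mod_cast hh
      have h3 : 0 ≤ 1 / (V + h - 1) := one_div_nonneg.2 (by linarith)
      linarith
    calc _ ≤ 4 * M * F * V ^ 2 * (1 / V) := by gcongr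
      _ = _ := by field_simp

/-- The probability that `t` has second degree at least `k` only because of its grandchildren. -/
noncomputable def exceptionProb (a : ℝ) (ha : 0 < a) (n k t : ℕ) : ℝ :=
  if h : t < n then expect a ha n fun G => if IsException k G ⟨t, h⟩ then 1 else 0 else 0

theorem exceptionProb_le_one (n k t : ℕ) : exceptionProb a ha n k t ≤ 1 := by
  unfold exceptionProb
  split_ifs with h
  · refine (expect_mono fun G => ?_).trans_eq (expect_const (a := a) (ha := ha) (n := n) 1)
    split_ifs <;> norm_num
  · norm_num

theorem expect_card_exception (n k : ℕ) :
    (expect a ha n fun G => ((#{t : Fin n | IsException k G t} : ℕ) : ℝ)) =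
      ∑ t ∈ range n, exceptionProb a ha n k t := by
  rw [← Fin.sum_univ_eq_sum_range]
  simp only [Finset.card_filter, Nat.cast_sum]
  rw [expect_sum]
  refine Finset.sum_congr rfl fun t _ => ?_
  rw [exceptionProb, dif_pos t.isLt]
  simp

/-- Either the grandchildren alone reach half of `k`, or `w = k - parentDeg` is below half of `k`;
in the latter case the parent's indegree is at least `k / 2`, where `parentFreq` is small. -/
theorem exceptionProb_le_add (n k t : ℕ) (h : t < n) : exceptionProb a ha n k t ≤
    (expect a ha n fun G => if target G ⟨t, h⟩ ≠ ⟨t, h⟩ ∧ (k + 1) / 2 ≤ grandDeg G ⟨t, h⟩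
      then (1 : ℝ) else 0) +
    ∑ w ∈ Ico 1 ((k + 1) / 2), expect a ha n fun G =>
      if target G ⟨t, h⟩ ≠ ⟨t, h⟩ ∧ parentDeg G ⟨t, h⟩ = k - w ∧ w ≤ grandDeg G ⟨t, h⟩
      then (1 : ℝ) else 0 := by
  rw [exceptionProb, dif_pos h, ← expect_sum, ← expect_add]
  refine expect_mono fun G => ?_
  have hnn : ∀ w ∈ Ico 1 ((k + 1) / 2), (0 : ℝ) ≤ if target G ⟨t, h⟩ ≠ ⟨t, h⟩ ∧
      parentDeg G ⟨t, h⟩ = k - w ∧ w ≤ grandDeg G ⟨t, h⟩ then (1 : ℝ) else 0 := by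
    intro w _
    split_ifs <;> norm_num
  have hsum := Finset.sum_nonneg hnn
  by_cases hE : IsException k G ⟨t, h⟩
  · obtain ⟨h1, h2, h3⟩ := id hE
    rw [if_pos hE]
    by_cases hW : (k + 1) / 2 ≤ grandDeg G ⟨t, h⟩
    · rw [if_pos ⟨h1, hW⟩]
      linarith
    · rw [if_neg (fun h' => hW h'.2), zero_add]
      refine le_trans ?_ (Finset.single_le_sum hnn (a := k - parentDeg G ⟨t, h⟩) ?_)
      · rw [if_pos ⟨h1, by omega, by omega⟩]
      · rw [Finset.mem_Ico]
        omega
  · rw [if_neg hE]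
    refine add_nonneg ?_ hsum
    split_ifs <;> norm_num

/-- The first term is the `m`-th moment bound at `k / 2`. The second sums the joint bounds over `w`,
using moments 0 and 2 only; both kinds of logarithmic factor come from `dualWeight`. -/
theorem exceptionProb_bound (ha : 0 < a) (m : ℕ) : ∃ C : ℝ, 0 < C ∧ ∀ n k t : ℕ, 1 ≤ k → 1 ≤ t →
    1 ≤ a * t → t < n → exceptionProb a ha n k t ≤
      C * ((1 + Real.log (n / t)) ^ m / (k : ℝ) ^ m * ((n : ℝ) / t) ^ (m / (a + 1))) +
      C * ((1 + Real.log (n / t)) * ((n / (k : ℝ) ^ (a + 1) + 1) / t)) := by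
  obtain ⟨K, hK0, hK⟩ := degError_bound ha
  obtain ⟨A, hA0, hA⟩ := parentFreq_le ha
  set P : ℝ := ∏ i ∈ range m, (a + i) with hP
  have hP0 : 0 ≤ P := Finset.prod_nonneg fun i _ => by positivity
  set C₁ : ℝ := 2 ^ m * (P * (1 + m * (2 * a + 1)) ^ m) with hC₁
  set C₂ : ℝ := 4 * (1 + a * (a + 1)) * ((1 + 2 * (2 * a + 1)) * (A * 2 ^ (a + 1) + K)) with hC₂
  have hC₁0 : 0 ≤ C₁ := by positivity
  have hC₂0 : 0 < C₂ := by positivity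
  refine ⟨C₁ + C₂, by positivity, fun n k t hk ht hat htn => ?_⟩
  have ht0 : (0 : ℝ) < t := by exact_mod_cast ht
  have hk0 : (0 : ℝ) < k := by exact_mod_cast hk
  have hn0 : (0 : ℝ) < n := by exact_mod_cast (by omega : 0 < n)
  have hH0 := logTime_nonneg ha t n
  have hH1 := logTime_le ha ht htn
  have hH2 := mul_exp_logTime_le ha ht htn
  set H := logTime a t n with hH
  set Λ := 1 + Real.log (n / t) with hΛ
  have hΛ1 : 1 ≤ Λ := by linarith
  have hS : ∀ m : ℕ, dualWeight a m (t + 1) n ≤ (1 + m * (2 * a + 1)) * Λ := by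
    intro m
    have h1 : dualWeight a m (t + 1) n = 1 + m * (2 * a + 1) * H := rfl
    rw [h1, add_mul, one_mul]
    gcongr
    linarith
  refine (exceptionProb_le_add n k t htn).trans (add_le_add ?_ ?_)
  · have h1 := expect_grandDeg_tail_le ha m ((k + 1) / 2) t n htn
    set E := expect a ha n fun G => if target G ⟨t, htn⟩ ≠ ⟨t, htn⟩ ∧
      (k + 1) / 2 ≤ grandDeg G ⟨t, htn⟩ then (1 : ℝ) else 0 with hE
    have hE0 : 0 ≤ E := expect_nonneg fun G => by split_ifs <;> norm_num
    have h2 : (k : ℝ) / 2 ≤ ((k + 1) / 2 : ℕ) := by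
      rw [div_le_iff₀ two_pos]
      exact_mod_cast (by omega : k ≤ (k + 1) / 2 * 2)
    have h3 : Real.exp (m * H) ≤ ((n : ℝ) / t) ^ (m / (a + 1)) := by
      calc Real.exp (m * H) = Real.exp ((a + 1) * H) ^ (m / (a + 1)) := by
            rw [← Real.exp_mul]
            congr 1
            field_simp
        _ ≤ _ := by gcongr
    have h4 : ((k : ℝ) / 2) ^ m * E ≤
        P * (((1 + m * (2 * a + 1)) * Λ) ^ m * ((n : ℝ) / t) ^ (m / (a + 1))) := by
      refine le_trans ?_ (h1.trans ?_)
      · gcongr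
      · have := one_le_dualWeight ha m (t + 1) n
        gcongr
        exact hS m
    have h5 : E ≤ C₁ * (Λ ^ m / (k : ℝ) ^ m * ((n : ℝ) / t) ^ (m / (a + 1))) := by
      rw [div_pow, div_mul_eq_mul_div, div_le_iff₀ (by positivity)] at h4
      rw [div_mul_eq_mul_div, mul_div_assoc', le_div_iff₀ (by positivity), mul_comm, hC₁]
      refine h4.trans_eq ?_
      rw [mul_pow]
      ring
    refine h5.trans ?_
    gcongr
    linarith
  · set D : ℝ := A * 2 ^ (a + 1) / (k : ℝ) ^ (a + 1) with hD
    set F : ℝ := D * Real.exp (a * H) + K / denom a t * Real.exp (-H) with hF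
    set S := dualWeight a 2 (t + 1) n with hSdef
    have hS1 : 1 ≤ S := one_le_dualWeight ha _ _ _
    have hτ := denom_pos' ha t
    have hD0 : 0 < D := by positivity
    have hF0 : 0 ≤ F := by positivity
    have hfreq : ∀ w ∈ Ico 1 ((k + 1) / 2), parentFreq a (k - w) ≤ D := by
      intro w hw
      rw [Finset.mem_Ico] at hw
      have h1 := hA (k - w) (by omega)
      have h2 : (k : ℝ) / 2 ≤ (k - w : ℕ) := by
        rw [div_le_iff₀ two_pos]
        exact_mod_cast (by omega : k ≤ (k - w) * 2)
      have h3 : ((k : ℝ) / 2) ^ (a + 1) * parentFreq a (k - w) ≤ A := by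
        refine le_trans ?_ h1
        have := parentFreq_pos ha (k - w)
        gcongr
      rw [Real.div_rpow hk0.le two_pos.le, div_mul_eq_mul_div, div_le_iff₀ (by positivity)] at h3
      rw [hD, le_div_iff₀ (by positivity)]
      linarith
    have hV1 : 1 ≤ S * Real.exp H :=
      one_le_mul_of_one_le_of_one_le hS1 (Real.one_le_exp hH0)
    have hexp : ∀ x : ℝ, Real.exp ((a + x) * H) = Real.exp (a * H) * Real.exp (x * H) := by
      intro x
      rw [← Real.exp_add]
      congr 1
      ring
    -- `V` is the typical scale of `grandDeg` and `F` bounds the law of the parent's indegree; in `F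
    -- * V` the exponentials combine to `exp ((a+1) H) ≤ n / t` and to 1.
    refine (sum_le_of_sq_bound (F := F) (V := S * Real.exp H) (M := 1 + a * (a + 1)) hF0 hV1
      (by positivity) ?_ ?_ ?_).trans ?_
    · intro w _
      exact expect_nonneg fun G => by split_ifs <;> norm_num
    · intro w hw
      have h1 := expect_joint_tail_le ha hK 0 w (k - w) t n hat htn
      simp only [pow_zero, one_mul, Finset.range_zero, Finset.prod_empty, Nat.cast_zero, add_zero,
        zero_sub, neg_mul] at h1
      refine h1.trans ?_
      have h2 := hfreq w hw
      calc _ ≤ F := by rw [hF]; gcongr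
        _ ≤ (1 + a * (a + 1)) * F := le_mul_of_one_le_left hF0 (by
          have : 0 < a * (a + 1) := by positivity
          linarith)
    · intro w hw
      have h1 := expect_joint_tail_le ha hK 2 w (k - w) t n hat htn
      refine h1.trans ?_
      have h2 := hfreq w hw
      have hfp := parentFreq_pos ha (k - w)
      have h3 : ∏ i ∈ range 2, (a + (i : ℝ)) = a * (a + 1) := by
        simp [Finset.prod_range_succ]
      have h4 : Real.exp (((2 : ℕ) : ℝ) * H) = Real.exp H ^ 2 := by
        rw [← Real.exp_nat_mul]
      have h5 : Real.exp ((((2 : ℕ) : ℝ) - 1) * H) = Real.exp H ^ 2 * Real.exp (-H) := by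
        rw [← h4, ← Real.exp_add]
        congr 1
        push_cast
        ring
      rw [h3, hexp, h4, h5]
      calc a * (a + 1) * (S ^ 2 * (parentFreq a (k - w) * (Real.exp (a * H) * Real.exp H ^ 2) +
            K / denom a t * (Real.exp H ^ 2 * Real.exp (-H))))
          ≤ (1 + a * (a + 1)) * (S ^ 2 * (D * (Real.exp (a * H) * Real.exp H ^ 2) +
            K / denom a t * (Real.exp H ^ 2 * Real.exp (-H)))) := by
            gcongr
            linarith
        _ = _ := by rw [hF]; ring
    · have h1 : F * (S * Real.exp H) = S * (D * Real.exp ((a + 1) * H) + K / denom a t) := by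
        have h2 := hexp 1
        rw [one_mul] at h2
        have h3 : Real.exp (-H) * Real.exp H = 1 := by
          rw [← Real.exp_add, neg_add_cancel, Real.exp_zero]
        rw [h2, hF]
        linear_combination (S * (K / denom a t)) * h3
      have h2 : K / denom a t ≤ K / t := by
        gcongr
        unfold denom
        nlinarith
      have h3 : D * Real.exp ((a + 1) * H) ≤ D * (n / t) := by gcongr
      have h4 : D * (n / t) + K / t ≤
          (A * 2 ^ (a + 1) + K) * ((n / (k : ℝ) ^ (a + 1) + 1) / t) := by
        have h5 : (A * 2 ^ (a + 1) + K) * ((n / (k : ℝ) ^ (a + 1) + 1) / t) =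
            D * (n / t) + K / t + (A * 2 ^ (a + 1) / t + K * (n / (k : ℝ) ^ (a + 1)) / t) := by
          rw [hD]
          ring
        rw [h5]
        refine le_add_of_nonneg_right ?_
        positivity
      rw [h1]
      calc 4 * (1 + a * (a + 1)) * (S * (D * Real.exp ((a + 1) * H) + K / denom a t))
          ≤ 4 * (1 + a * (a + 1)) * (((1 + 2 * (2 * a + 1)) * Λ) *
            ((A * 2 ^ (a + 1) + K) * ((n / (k : ℝ) ^ (a + 1) + 1) / t))) := by
            gcongr
            · exact_mod_cast hS 2
            · linarith
        _ = C₂ * (Λ * ((n / (k : ℝ) ^ (a + 1) + 1) / t)) := by rw [hC₂]; ring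
        _ ≤ _ := by
          gcongr
          linarith

end Exceptions

/-! ### Summing the exceptional probabilities over all vertices -/

section Summation

theorem half_le_log {k : ℕ} (hk : 2 ≤ k) : 1 / 2 ≤ Real.log k := by
  have h1 : Real.log 2 ≤ Real.log k :=
    Real.log_le_log two_pos (by exact_mod_cast hk)
  have := Real.log_two_gt_d9
  linarith

/-- The factor `2 ^ q` is there because `log k` is below 1 at `k = 2`; `2 * log k` is always at
least 1. -/
theorem rpow_log_le {k q : ℕ} (hk : 2 ≤ k) {y : ℝ} (hy : 0 ≤ y) (hyq : y ≤ q) :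
    Real.log k ^ y ≤ 2 ^ q * Real.log k ^ q := by
  have hL := half_le_log hk
  have h1 : (2 * Real.log k) ^ y ≤ (2 * Real.log k) ^ (q : ℝ) :=
    Real.rpow_le_rpow_of_exponent_le (by linarith) hyq
  rw [Real.rpow_natCast, mul_pow, Real.mul_rpow two_pos.le (by linarith)] at h1
  have h2 : (1 : ℝ) ≤ 2 ^ y := Real.one_le_rpow one_le_two hy
  have h3 : 0 ≤ Real.log k ^ y := Real.rpow_nonneg (by linarith) _
  nlinarith

theorem sq_log_le {k : ℕ} (hk : 1 ≤ k) : Real.log k ^ 2 ≤ 4 * (k : ℝ) := by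
  have hk0 : (0 : ℝ) < k := by exact_mod_cast hk
  have h1 : Real.log k = 2 * Real.log (√k) := by
    rw [Real.log_sqrt hk0.le]
    ring
  have h2 : Real.log (√k) ≤ √k := (Real.log_le_sub_one_of_pos (by positivity)).trans (by linarith)
  have h3 : 0 ≤ Real.log k := Real.log_natCast_nonneg k
  calc Real.log k ^ 2 ≤ (2 * √(k : ℝ)) ^ 2 := by gcongr; linarith
    _ = 4 * (k : ℝ) := by rw [mul_pow, Real.sq_sqrt hk0.le]; norm_num

theorem sum_Ico_one_div_le {T n : ℕ} (hT : 1 ≤ T) (h : T ≤ n) :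
    ∑ t ∈ Ico T n, 1 / (t : ℝ) ≤ 2 * Real.log (n / T) := by
  have hT0 : (0 : ℝ) < T := by exact_mod_cast hT
  induction n, h using Nat.le_induction with
  | base => simp [hT0.ne']
  | succ n h ih =>
    have hn1 : (1 : ℝ) ≤ n := by exact_mod_cast hT.trans h
    have hn0 : (0 : ℝ) < n := by linarith
    rw [Finset.sum_Ico_succ_top h]
    rw [Real.log_div hn0.ne' hT0.ne'] at ih
    rw [Real.log_div (by positivity) hT0.ne']
    have h1 := Real.one_sub_inv_le_log_of_pos (show 0 < ((n : ℝ) + 1) / n by positivity)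
    rw [Real.log_div (by positivity) hn0.ne'] at h1
    have h2 : 1 / (n : ℝ) ≤ 2 * (1 - (((n : ℝ) + 1) / n)⁻¹) := by
      have h3 : 2 * (1 - (((n : ℝ) + 1) / n)⁻¹) = 2 / (n + 1) := by
        field_simp
        ring
      rw [h3, div_le_div_iff₀ hn0 (by positivity)]
      linarith
    push_cast
    linarith

theorem sum_Ico_one_div_sq_le {T n : ℕ} (hT : 1 ≤ T) :
    ∑ t ∈ Ico T n, 1 / (t : ℝ) ^ 2 ≤ 2 / (T : ℝ) := by
  obtain ⟨T, rfl⟩ := Nat.exists_eq_add_of_le' hT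
  have h := sum_Ioo_inv_sq_le (α := ℝ) T n
  have h1 : Ico (T + 1) n = Ioo T n := by
    ext t
    simp only [Finset.mem_Ico, Finset.mem_Ioo]
    omega
  rw [h1]
  push_cast
  simpa only [one_div] using h

theorem sum_Ico_rpow_le {T n : ℕ} (hT : 1 ≤ T) {p : ℝ} (hp : 2 ≤ p) :
    ∑ t ∈ Ico T n, ((n : ℝ) / t) ^ p ≤ 2 * n * ((n : ℝ) / T) ^ (p - 1) := by
  have hT0 : (0 : ℝ) < T := by exact_mod_cast hT
  rcases Nat.eq_zero_or_pos n with rfl | hn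
  · simp
  have hn0 : (0 : ℝ) < n := by exact_mod_cast hn
  calc ∑ t ∈ Ico T n, ((n : ℝ) / t) ^ p
      ≤ ∑ t ∈ Ico T n, ((n : ℝ) / T) ^ (p - 2) * n ^ 2 * (1 / (t : ℝ) ^ 2) := by
        refine Finset.sum_le_sum fun t ht => ?_
        have hTt : (T : ℝ) ≤ t := by exact_mod_cast (Finset.mem_Ico.1 ht).1
        have ht0 : (0 : ℝ) < t := by linarith
        have h1 : ((n : ℝ) / t) ^ p = ((n : ℝ) / t) ^ (p - 2) * ((n : ℝ) / t) ^ 2 := by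
          rw [← Real.rpow_natCast _ 2, ← Real.rpow_add (by positivity)]
          norm_num
        rw [h1, div_pow, mul_assoc, mul_one_div]
        have : 0 ≤ p - 2 := by linarith
        gcongr
    _ = ((n : ℝ) / T) ^ (p - 2) * n ^ 2 * ∑ t ∈ Ico T n, 1 / (t : ℝ) ^ 2 := by
        rw [Finset.mul_sum]
    _ ≤ ((n : ℝ) / T) ^ (p - 2) * n ^ 2 * (2 / T) := by
        gcongr
        exact sum_Ico_one_div_sq_le hT
    _ = 2 * n * (((n : ℝ) / T) ^ (p - 2) * (n / T)) := by ring
    _ = _ := by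
        rw [← Real.rpow_add_one (by positivity)]
        congr 2
        ring

variable {a : ℝ}

theorem sum_exceptionProb_bound (ha : 0 < a) : ∃ C : ℝ, 0 < C ∧ ∀ n k : ℕ, 1 ≤ n → 2 ≤ k →
    ∑ t ∈ range n, exceptionProb a ha n k t ≤
      C * (n / (k : ℝ) ^ (a + 1) * Real.log k ^ ⌈a + 1⌉₊ + k) := by
  set q : ℕ := ⌈a + 1⌉₊ with hq
  have haq : a + 1 ≤ q := Nat.le_ceil _
  have hq2 : (2 : ℝ) ≤ q := by
    have : 1 < q := by
      have : (1 : ℝ) < q := by linarith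
      exact_mod_cast this
    exact_mod_cast this
  -- This order makes the exponent `m / (a + 1)` at least 2, so the sum of `(n / t)` to that power
  -- is dominated by its lower end.
  set m : ℕ := 2 * q with hm
  obtain ⟨C, hC, hbound⟩ := exceptionProb_bound ha m
  set b : ℝ := 2 + 2 * (a + 1) with hb
  have hb0 : 0 < b := by positivity
  set c₀ : ℕ := ⌈1 / a⌉₊ with hc₀
  set C' : ℝ := C * b * (4 * (a + 1)) with hC'
  have hC'0 : 0 < C' := by positivity
  refine ⟨(1 + 2 * C * b ^ m) * 2 ^ q + (c₀ + 2) + C' * (2 ^ q + 4), by positivity,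
    fun n k hn hk => ?_⟩
  have hn0 : (0 : ℝ) < n := by exact_mod_cast hn
  have hk1 : (1 : ℝ) ≤ k := by exact_mod_cast (by omega : 1 ≤ k)
  have hk0 : (0 : ℝ) < k := by linarith
  set L := Real.log k with hL
  have hL2 : 1 / 2 ≤ L := half_le_log hk
  have hL0 : 0 < L := by linarith
  set x : ℝ := n * (L / k) ^ (a + 1) with hx
  have hx0 : 0 < x := by positivity
  have hxR : x = n / (k : ℝ) ^ (a + 1) * L ^ (a + 1) := by
    rw [hx, Real.div_rpow hL0.le hk0.le]
    ring
  -- At the cutoff `x` the `m`-th moment bound, summed over `t ≥ T`, is again of order `x`, the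
  -- trivial bound for `t < T`. Adding `c₀` secures `a * t ≥ 1`.
  set T : ℕ := ⌈x⌉₊ + c₀ + 1 with hT
  have hT1 : 1 ≤ T := by omega
  have hT0 : (0 : ℝ) < T := by exact_mod_cast hT1
  have hxT : x ≤ T := (Nat.le_ceil x).trans (by exact_mod_cast (by omega : ⌈x⌉₊ ≤ T))
  have hTx : (T : ℝ) ≤ x + (c₀ + 2) := by
    have := (Nat.ceil_lt_add_one hx0.le).le
    rw [hT]
    push_cast
    linarith
  have hnT : (n : ℝ) / T ≤ (k / L) ^ (a + 1) := by
    calc (n : ℝ) / T ≤ n / x := by gcongr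
      _ = (k / L) ^ (a + 1) := by
        rw [hx, Real.div_rpow hL0.le hk0.le, Real.div_rpow hk0.le hL0.le]
        field_simp
  have hlogT : Real.log (n / T) ≤ 2 * (a + 1) * L := by
    have h1 : Real.log (n / T) ≤ (a + 1) * Real.log (k / L) := by
      rw [← Real.log_rpow (by positivity)]
      exact Real.log_le_log (by positivity) hnT
    have h2 : Real.log (k / L) ≤ 2 * L := by
      rw [Real.log_div hk0.ne' hL0.ne']
      have h3 := Real.one_sub_inv_le_log_of_pos hL0
      have h4 : L⁻¹ ≤ 1 + L := by
        rw [inv_le_iff_one_le_mul₀ hL0]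
        -- The bound `1 / 2` on `L` is too weak here: `L * (1 + L) ≥ 1` is needed, and it holds from
        -- `log 2` on.
        have h5 := Real.log_two_gt_d9
        have h6 : Real.log 2 ≤ L := Real.log_le_log two_pos (by exact_mod_cast hk)
        nlinarith
      linarith
    calc _ ≤ (a + 1) * Real.log (k / L) := h1
      _ ≤ (a + 1) * (2 * L) := by gcongr
      _ = _ := by ring
  have hsplit : ∑ t ∈ range n, exceptionProb a ha n k t ≤
      T + ∑ t ∈ Ico T n, exceptionProb a ha n k t := by
    rcases le_total T n with h | h
    · rw [← Finset.sum_range_add_sum_Ico _ h]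
      gcongr
      refine (Finset.sum_le_sum fun t _ => exceptionProb_le_one n k t).trans_eq ?_
      simp
    · rw [Finset.Ico_eq_empty_of_le h, Finset.sum_empty, add_zero]
      refine (Finset.sum_le_sum fun t _ => exceptionProb_le_one n k t).trans ?_
      simpa using h
  set R : ℝ := n / (k : ℝ) ^ (a + 1) with hR
  have hR0 : 0 < R := by positivity
  have hterm : ∀ t ∈ Ico T n, exceptionProb a ha n k t ≤
      C * (b ^ m * L ^ m / (k : ℝ) ^ m) * ((n : ℝ) / t) ^ (m / (a + 1)) +
      C * b * L * (R + 1) * (1 / t) := by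
    intro t ht
    rw [Finset.mem_Ico] at ht
    have hTt : (T : ℝ) ≤ t := by exact_mod_cast ht.1
    have ht0 : (0 : ℝ) < t := by linarith
    have hat : 1 ≤ a * t := by
      have h1 : 1 / a ≤ t := (Nat.le_ceil _).trans (by exact_mod_cast (by omega : c₀ ≤ t))
      rw [div_le_iff₀ ha] at h1
      linarith
    have hΛ0 : 0 ≤ Real.log (n / t) := by
      refine Real.log_nonneg ?_
      rw [le_div_iff₀ ht0, one_mul]
      exact_mod_cast ht.2.le
    have hΛ : 1 + Real.log (n / t) ≤ b * L := by
      have h1 : Real.log (n / t) ≤ Real.log (n / T) :=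
        Real.log_le_log (by positivity) (by gcongr)
      rw [hb]
      linarith
    refine (hbound n k t (by omega) (by omega) hat ht.2).trans (add_le_add ?_ ?_)
    · rw [mul_assoc, ← mul_pow]
      gcongr
    · calc C * ((1 + Real.log (n / t)) * ((R + 1) / t)) ≤ C * ((b * L) * ((R + 1) / t)) := by
            gcongr
        _ = _ := by ring
  have hp : 2 ≤ (m : ℝ) / (a + 1) := by
    rw [le_div_iff₀ (by positivity), hm]
    push_cast
    linarith
  have hA : C * (b ^ m * L ^ m / (k : ℝ) ^ m) * ∑ t ∈ Ico T n, ((n : ℝ) / t) ^ (m / (a + 1)) ≤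
      2 * C * b ^ m * x := by
    have h1 : ((n : ℝ) / T) ^ ((m : ℝ) / (a + 1) - 1) ≤ (k / L) ^ m / (k / L) ^ (a + 1) := by
      calc ((n : ℝ) / T) ^ ((m : ℝ) / (a + 1) - 1)
          ≤ ((k / L) ^ (a + 1)) ^ ((m : ℝ) / (a + 1) - 1) := by
            have : 0 ≤ (m : ℝ) / (a + 1) - 1 := by linarith
            gcongr
        _ = _ := by
            rw [← Real.rpow_mul (by positivity), ← Real.rpow_natCast (k / L) m,
              ← Real.rpow_sub (by positivity)]
            congr 1
            field_simp
    calc _ ≤ C * (b ^ m * L ^ m / (k : ℝ) ^ m) *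
          (2 * n * ((k / L) ^ m / (k / L) ^ (a + 1))) := by
          gcongr
          refine (sum_Ico_rpow_le hT1 hp).trans ?_
          gcongr
      _ = 2 * C * b ^ m * x := by
          rw [hx, Real.div_rpow hL0.le hk0.le, Real.div_rpow hk0.le hL0.le, div_pow]
          field_simp
  have hB : C * b * L * (R + 1) * ∑ t ∈ Ico T n, 1 / (t : ℝ) ≤ C' * ((R + 1) * L ^ 2) := by
    have h1 : ∑ t ∈ Ico T n, 1 / (t : ℝ) ≤ 4 * (a + 1) * L := by
      rcases le_total T n with h | h
      · have := sum_Ico_one_div_le hT1 h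
        linarith
      · rw [Finset.Ico_eq_empty_of_le h, Finset.sum_empty]
        positivity
    calc _ ≤ C * b * L * (R + 1) * (4 * (a + 1) * L) := by gcongr
      _ = _ := by rw [hC']; ring
  have hmain : ∑ t ∈ Ico T n, exceptionProb a ha n k t ≤
      2 * C * b ^ m * x + C' * ((R + 1) * L ^ 2) := by
    refine (Finset.sum_le_sum hterm).trans ?_
    rw [Finset.sum_add_distrib, ← Finset.mul_sum, ← Finset.mul_sum]
    exact add_le_add hA hB
  have hxq : x ≤ 2 ^ q * (R * L ^ q) := by
    rw [hxR]
    have := rpow_log_le hk (by positivity : 0 ≤ a + 1) haq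
    calc _ ≤ R * (2 ^ q * L ^ q) := by gcongr
      _ = _ := by ring
  have hL2q : (R + 1) * L ^ 2 ≤ 2 ^ q * (R * L ^ q) + 4 * k := by
    have h1 := rpow_log_le hk (by norm_num : (0 : ℝ) ≤ 2) hq2
    rw [Real.rpow_two] at h1
    have h2 := sq_log_le (by omega : 1 ≤ k)
    calc (R + 1) * L ^ 2 = R * L ^ 2 + L ^ 2 := by ring
      _ ≤ R * (2 ^ q * L ^ q) + 4 * k := by gcongr
      _ = _ := by ring
  set Q := R * L ^ q with hQ
  have hQ0 : 0 < Q := by positivity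
  calc _ ≤ (x + (c₀ + 2)) + (2 * C * b ^ m * x + C' * ((R + 1) * L ^ 2)) :=
        hsplit.trans (add_le_add hTx hmain)
    _ = (1 + 2 * C * b ^ m) * x + (c₀ + 2) * 1 + C' * ((R + 1) * L ^ 2) := by ring
    _ ≤ (1 + 2 * C * b ^ m) * (2 ^ q * Q) + (c₀ + 2) * k + C' * (2 ^ q * Q + 4 * k) := by gcongr
    _ ≤ (1 + 2 * C * b ^ m) * (2 ^ q * (Q + k)) + (c₀ + 2) * (Q + k) +
        C' * (2 ^ q * (Q + k) + 4 * (Q + k)) := by gcongr <;> linarith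
    _ = _ := by ring

end Summation

/-! ### Assembly of the main term and the errors -/

theorem expectedKVertices_bound {a : ℝ} (ha : 0 < a) : ∃ C : ℝ, 0 < C ∧ ∀ n k : ℕ, 1 ≤ n → 2 ≤ k →
    |expectedKVertices a ha n k - tailConst a / (k : ℝ) ^ a * n| ≤
      C * (n / (k : ℝ) ^ (a + 1) * Real.log k ^ ⌈a + 1⌉₊ + k) := by
  obtain ⟨K, hK0, hK⟩ := expect_numLargeParent_bound ha
  obtain ⟨A, hA0, hA⟩ := limitTail_bound ha
  obtain ⟨B, hB0, hB⟩ := parentFreq_le ha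
  obtain ⟨D, hD0, hD⟩ := sum_exceptionProb_bound ha
  set q : ℕ := ⌈a + 1⌉₊ with hq
  refine ⟨(A + B + 1) * 2 ^ q + (2 * K + 1 + (a + 1)) + D, by positivity, fun n k hn hk => ?_⟩
  have hn0 : (0 : ℝ) < n := by exact_mod_cast hn
  have hk1 : (1 : ℝ) ≤ k := by exact_mod_cast (by omega : 1 ≤ k)
  have hk0 : (0 : ℝ) < k := by linarith
  have hL := half_le_log hk
  set L := Real.log k with hLdef
  set R : ℝ := n / (k : ℝ) ^ (a + 1) with hR
  have hR0 : 0 < R := by positivity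
  have hRQ : R ≤ 2 ^ q * (R * L ^ q) := by
    have h := rpow_log_le (q := q) hk le_rfl (Nat.cast_nonneg q)
    rw [Real.rpow_zero] at h
    calc R = R * 1 := (mul_one R).symm
      _ ≤ R * (2 ^ q * L ^ q) := by gcongr
      _ = _ := by ring
  -- The loop term is absorbed by applying `log x ≤ x - 1` to `R = n / k^(a+1)` and to `k`.
  have hlog : Real.log n ≤ R + (a + 1) * k := by
    have h1 : Real.log R = Real.log n - (a + 1) * Real.log k := by
      rw [hR, Real.log_div hn0.ne' (by positivity), Real.log_rpow hk0]
    have h2 := Real.log_le_sub_one_of_pos hR0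
    have h3 := Real.log_le_sub_one_of_pos hk0
    have h4 : (a + 1) * Real.log k ≤ (a + 1) * k := by
      gcongr
      linarith
    linarith
  have hloops : (expect a ha n fun G => (numLoops G : ℝ)) ≤ 1 + Real.log n :=
    expect_numLoops_le n hn
  have htail : |n * limitTail a k - tailConst a / (k : ℝ) ^ a * n| ≤ A * R := by
    have h := mul_le_mul_of_nonneg_left (hA k (by omega)) hn0.le
    rw [← abs_of_pos hn0, ← abs_mul, abs_of_pos hn0] at h
    refine le_trans (le_of_eq ?_) (h.trans_eq ?_)
    · congr 1
      ring
    · rw [hR]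
      ring
  -- The lower bound involves `k + 1` in place of `k`; the lost term `k * limitFreq a k` is
  -- `O(k^(-a-1))`.
  have hnext : n * limitTail a k - B * R ≤ n * limitTail a (k + 1) := by
    have h1 := sum_mul_limitFreq ha (k + 1)
    rw [Finset.sum_range_succ, sum_mul_limitFreq ha] at h1
    have h2 : (k : ℝ) * limitFreq a k ≤ B / (k : ℝ) ^ (a + 1) := by
      rw [le_div_iff₀ (by positivity), mul_comm]
      refine le_trans ?_ (hB k (by omega))
      have := limitFreq_pos ha k
      unfold parentFreq
      gcongr
      linarith
    have h3 : (n : ℝ) * (k * limitFreq a k) ≤ B * R := by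
      calc _ ≤ n * (B / (k : ℝ) ^ (a + 1)) := by gcongr
        _ = _ := by rw [hR]; ring
    have h4 : limitTail a (k + 1) = limitTail a k - k * limitFreq a k := by linarith
    rw [h4, mul_sub]
    linarith
  have hlower : (expect a ha n fun G => (numLargeParent (k + 1) G : ℝ)) ≤
      expectedKVertices a ha n k + expect a ha n fun G => (numLoops G : ℝ) := by
    change _ ≤ (expect a ha n fun G => (numKVertices k G : ℝ)) + _
    rw [← expect_add]
    exact expect_mono fun G => by exact_mod_cast numLargeParent_le k G
  have hupper : expectedKVertices a ha n k ≤ (expect a ha n fun G => (numLargeParent k G : ℝ)) +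
      (expect a ha n fun G => (numLoops G : ℝ)) + ∑ t ∈ range n, exceptionProb a ha n k t := by
    change (expect a ha n fun G => (numKVertices k G : ℝ)) ≤ _
    rw [← expect_card_exception, ← expect_add, ← expect_add]
    exact expect_mono fun G => by exact_mod_cast numKVertices_le k G
  have h1 := abs_le.1 (hK n k (by omega))
  have h2 := abs_le.1 (hK n (k + 1) (by omega))
  have h3 := hD n k hn hk
  have h4 := abs_le.1 htail
  push_cast at h2
  set Q := R * L ^ q with hQ
  have hQ0 : 0 < Q := by
    have : 0 < L := by linarith
    positivity
  have h5 : (A + B + 1) * R ≤ (A + B + 1) * (2 ^ q * Q) := by gcongr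
  have h6 : 0 ≤ (A + B + 1) * 2 ^ q * k := by positivity
  have h7 : 0 ≤ (2 * K + 1 + (a + 1)) * Q := by positivity
  have h8 : 0 ≤ D * (Q + k) := by positivity
  have h9 : K ≤ K * k := le_mul_of_one_le_right hK0.le hk1
  have h10 : 0 < A * R := by positivity
  have h11 : 0 < B * R := by positivity
  have h12 : 0 < K * k := by positivity
  have h13 : ((A + B + 1) * 2 ^ q + (2 * K + 1 + (a + 1)) + D) * (Q + k) =
      (A + B + 1) * (2 ^ q * Q) + (A + B + 1) * 2 ^ q * k + (2 * K + 1 + (a + 1)) * Q +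
      (2 * (K * k) + k + (a + 1) * k) + D * (Q + k) := by ring
  rw [abs_le, h13]
  constructor <;> linarith

theorem exists_add_eq_of_abs_le {r A B : ℝ} (hA : 0 ≤ A) (hB : 0 ≤ B) (h : |r| ≤ A + B) :
    ∃ x y : ℝ, |x| ≤ A ∧ |y| ≤ B ∧ x + y = r := by
  rw [abs_le] at h
  refine ⟨max (-A) (min r A), r - max (-A) (min r A), ?_, ?_, by ring⟩ <;>
    rw [abs_le] <;> constructor <;> grind

end BuckleyOsthus

theorem theorem2 (a : ℝ) (ha : 0 < a) :
    ∃ C : ℝ, 0 < C ∧ ∀ n k : ℕ, 1 ≤ n → 1 < k →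
      ∃ ε₁ ε₂ : ℝ,
        |ε₁| ≤ C * (Real.log k ^ ⌈a + 1⌉₊ / (k : ℝ)) ∧
        |ε₂| ≤ C * ((k : ℝ) ^ (1 + a) / (n : ℝ)) ∧
        BuckleyOsthus.expectedKVertices a ha n k =
          (a + 1) * Real.Gamma (2 * a + 1) / (Real.Gamma (a + 1) * (k : ℝ) ^ a) * (n : ℝ)
            * (1 + ε₁ + ε₂) := by
  obtain ⟨C, hC, h⟩ := BuckleyOsthus.expectedKVertices_bound ha
  have hc := BuckleyOsthus.tailConst_pos ha
  refine ⟨C / BuckleyOsthus.tailConst a, by positivity, fun n k hn hk => ?_⟩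
  have hn0 : (0 : ℝ) < n := by exact_mod_cast hn
  have hk0 : (0 : ℝ) < k := by exact_mod_cast (by omega : 0 < k)
  have hL : 0 ≤ Real.log k := Real.log_natCast_nonneg k
  have hb := h n k hn hk
  have hM : (a + 1) * Real.Gamma (2 * a + 1) / (Real.Gamma (a + 1) * (k : ℝ) ^ a) =
      BuckleyOsthus.tailConst a / (k : ℝ) ^ a := by
    rw [BuckleyOsthus.tailConst, div_div]
  rw [hM]
  set c := BuckleyOsthus.tailConst a
  set M : ℝ := c / (k : ℝ) ^ a * n with hMdef
  have hM0 : 0 < M := by positivity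
  set Y := BuckleyOsthus.expectedKVertices a ha n k
  -- Dividing by the main term turns the two absolute errors into the two relative ones; the total
  -- is then split into `ε₁` and `ε₂` by truncation.
  have hr : |Y / M - 1| ≤ C / c * (Real.log k ^ ⌈a + 1⌉₊ / (k : ℝ)) +
      C / c * ((k : ℝ) ^ (1 + a) / (n : ℝ)) := by
    have h1 : Y / M - 1 = (Y - M) / M := by field_simp
    rw [h1, abs_div, abs_of_pos hM0, div_le_iff₀ hM0]
    refine hb.trans_eq ?_
    rw [hMdef, add_comm 1 a, Real.rpow_add_one hk0.ne']
    field_simp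
  obtain ⟨x, y, hx, hy, hxy⟩ :=
    BuckleyOsthus.exists_add_eq_of_abs_le (by positivity) (by positivity) hr
  refine ⟨x, y, hx, hy, ?_⟩
  rw [add_assoc, hxy, add_sub_cancel, mul_div_cancel₀ _ hM0.ne']
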